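/- A smooth function $c:\mathbb{R}\to\mathbb{R}$ with critical set $S(c)=\{x\mid c'(x)=0\}$ is called an $\mathbb{R}$-$\mathbb{R}$ TS function if $S(c)$ is a disjoint union of at most countably many sets, each of which is a point, a compact interval, a closed ray or $\mathbb{R}$. Let $m\ge 2$ and let $c_1,c_2$ be $\mathbb{R}$-$\mathbb{R}$ TS functions with $c_1(x)<c_2(x)$ for all $x$. Let $D=\{(x_1,x_2)\mid c_1(x_2)<x_1<c_2(x_2)\}$, with closure $\overline{D}$ in $\mathbb{R}^2$, and $$X_m=\Big\{(x_1,x_2,(y_j)_{j=1}^{m-1})\in\overline{D}\times\mathbb{R}^{m-1}\ \Big|\ (x_1-c_1(x_2))(c_2(x_2)-x_1)-\sum_{j=1}^{m-1}y_j^2=0\Big\}\subset\mathbb{R}^{m+1}.$$ A contour of a continuous real-valued function is a connected component of a level set of it; the Reeb space of the function is the quotient space of its domain obtained by collapsing each contour to a point, with the quotient topology. If $m=2$, assume in addition that the set $\{p\in\mathbb{R}\mid c_1(x)<p<c_2(x)\text{ for all }x\in\mathbb{R}\}$ is open in $\mathbb{R}$. Suppose that there is a discrete closed subset $Z_F\subset\mathbb{R}$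 with the following two properties. 1. The part of $c_1(S(c_1))\cup c_2(S(c_2))$ outside $Z_F$ is a discrete and closed subset of $\mathbb{R}-Z_F$. 2. For each $p\in Z_F$ and each contour $C$, contained in the level set of $p$, of the function $(x_1,x_2)\mapsto x_1$ on $\overline{D}$, there is a connected neighbourhood $K$ of $C$ in $\overline{D}$ which is closed in $\overline{D}$, is a union of contours of this function, and is such that $K-C$ contains no point of the form $(c_i(x),x)$ with $x\in S(c_i)$, $i=1,2$. Then the Reeb space of the function $X_m\to\mathbb{R}$ given by the first coordinate $x_1$ is a (Hausdorff) CW complex of dimension $1$. -/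

import Mathlib

open Set Topology
open scoped ContDiff

/-! ### Tame functions on the real line -/

/-- The critical set `S(c)` of a differentiable function `c : ℝ → ℝ`. -/
def critSet (c : ℝ → ℝ) : Set ℝ := {x | deriv c x = 0}

/-- The allowed pieces of the critical set: a point, a compact interval of positive length,
a closed ray, or the whole line. -/
def IsTamePiece (I : Set ℝ) : Prop :=
  (∃ a, I = {a}) ∨ (∃ a b, a < b ∧ I = Icc a b) ∨ (∃ a, I = Ici a) ∨ (∃ a, I = Iic a) ∨ I = univ

/-- A real-valued function on the real line with tame singularities: it is smooth, and its critical
set is the disjoint union of an (empty, finite or infinite) countable family of pieces. -/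
def IsTS (c : ℝ → ℝ) : Prop :=
  ContDiff ℝ ∞ c ∧
    ∃ F : Set (Set ℝ), F.Countable ∧ F.PairwiseDisjoint id ∧ (∀ I ∈ F, IsTamePiece I) ∧
      ⋃₀ F = critSet c

/-- The set of all critical values of `c₁` and `c₂`. -/
def critValues (c₁ c₂ : ℝ → ℝ) : Set ℝ := c₁ '' critSet c₁ ∪ c₂ '' critSet c₂

/-! ### Contours and Reeb spaces -/

section Reeb

variable {Y : Type*} [TopologicalSpace Y]

/-- The contour of `f` through `y`: the connected component containing `y` of the level set of `f`
containing `y`. -/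
def contour (f : Y → ℝ) (y : Y) : Set Y := connectedComponentIn (f ⁻¹' {f y}) y

/-- Two points are equivalent when they lie on the same contour. -/
def reebSetoid (f : Y → ℝ) : Setoid Y := Setoid.ker (contour f)

/-- The Reeb space of `f`, with the quotient topology. -/
abbrev ReebSpace (f : Y → ℝ) : Type _ := Quotient (reebSetoid f)

end Reeb

/-- The topological space `R` is a (Hausdorff) CW complex of dimension exactly one, for a suitable
cell structure. -/
def IsOneDimCW (R : Type*) [TopologicalSpace R] : Prop :=
  T2Space R ∧ ∃ cw : CWComplex (univ : Set R),
    Nonempty (cw.cell 1) ∧ ∀ n, 2 ≤ n → IsEmpty (cw.cell n)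

/-! ### The region between two graphs and the hypersurface over it -/

/-- The open region `D` surrounded by the graphs; the first coordinate is the value. -/
def region (c₁ c₂ : ℝ → ℝ) : Set (ℝ × ℝ) := {z | c₁ z.2 < z.1 ∧ z.1 < c₂ z.2}

/-- The projection to the first coordinate on the closure of the region. -/
def regionProj (c₁ c₂ : ℝ → ℝ) (z : closure (region c₁ c₂)) : ℝ := z.1.1

/-- The points `(cᵢ(x), x)` with `x` a critical point of `cᵢ`, `i = 1, 2`. -/
def critPoints (c₁ c₂ : ℝ → ℝ) : Set (ℝ × ℝ) :=
  (fun x => (c₁ x, x)) '' critSet c₁ ∪ (fun x => (c₂ x, x)) '' critSet c₂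

/-- The `m`-dimensional hypersurface `X` in `ℝ² × ℝ^(m-1) = ℝ^(m+1)`. -/
def hypersurface (m : ℕ) (c₁ c₂ : ℝ → ℝ) : Set ((ℝ × ℝ) × EuclideanSpace ℝ (Fin (m - 1))) :=
  {z | z.1 ∈ closure (region c₁ c₂) ∧
    (z.1.1 - c₁ z.1.2) * (c₂ z.1.2 - z.1.1) - ∑ j, z.2 j ^ 2 = 0}

/-- The projection to the first coordinate on the hypersurface. -/
def hypersurfaceProj (m : ℕ) (c₁ c₂ : ℝ → ℝ) (z : hypersurface m c₁ c₂) : ℝ := z.1.1.1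

/-- The set `K` is a closed connected neighbourhood, in the closure of the region, of the contour
through `z`; it is saturated (a union of contours), and outside this contour it contains no critical
point `(cᵢ(x), x)`. -/
structure IsGoodNhd (c₁ c₂ : ℝ → ℝ) (z : closure (region c₁ c₂))
    (K : Set (closure (region c₁ c₂))) : Prop where
  nhd : K ∈ 𝓝ˢ (contour (regionProj c₁ c₂) z)
  connected : IsConnected K
  saturated : ∀ w ∈ K, contour (regionProj c₁ c₂) w ⊆ K
  closed : IsClosed K
  noCrit : ∀ w ∈ K \ contour (regionProj c₁ c₂) z, (w : ℝ × ℝ) ∉ critPoints c₁ c₂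

/-! A contour of `x₁` on the closed region is a maximal interval of a line `{p} × ℝ` on which `c₁ ≤
p ≤ c₂`, so two points of a level lie on one contour exactly when they are `Linked`. A contour
without critical points can be followed to nearby levels along any column `x₂ = a` that it crosses
inside the open region. Hence the value is a local coordinate of the Reeb space off the critical
contours, which serve as vertices.

The conditions on `Z` enter only through `CritIsolated`: near a point of the closed region, critical
contours occur only on the level of that point. By Rolle's theorem each graph is then monotone on
small intervals to either side of any point, and all points near a given one are linked to finitely
many columns (`exists_finite_linked`).

This local picture is recorded as `IsGraphLike`. A critical contour may be unbounded and carry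
infinitely many branches, so its neighbourhoods in the Reeb space are hard to control directly.
`HasCharts.isGraphLike_of_isQuotientMap` allows the condition at a vertex to be checked upstairs, at
one point of the contour at a time, where finitely many columns suffice.

A Hausdorff graph-like space with a point off the vertices is a one-dimensional CW complex
(`IsGraphLike.isOneDimCW`). Off the vertices it splits into open edges, `f` is injective on each
closed edge, and edges with missing ends are cut into compact arcs by a sequence indexed by `ℤ`. The
condition on branches at the vertices yields the weak topology.

The hypersurface has over each point of the region a sphere of dimension `m - 2`, shrunk to a point
over the two graphs. For `m ≥ 3` the spheres are connected and the Reeb space does not change. For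
`m = 2` the fibre is a pair of points, identified once the contour reaches a graph, so the Reeb
space is doubled exactly over the levels lying strictly between both graphs. Openness of this set of
levels makes the two sheets open. At a frontier level outside it the level set is a whole line
touching a graph at a global extremum, hence a vertex. `IsGraphLike.of_doubling` then transfers the
graph structure. -/

/-! ### One-dimensional CW complexes assembled from arcs -/

/-- The characteristic map of a one-dimensional cell parametrised by a section `g` of `f` over
the interval from `a` to `b`. -/
noncomputable def arcEquiv {R : Type*} (f : R → ℝ) (g : ℝ → R) (a b : ℝ) (hab : a < b)
    (hg : ∀ t ∈ Ioo a b, f (g t) = t) : PartialEquiv (Fin 1 → ℝ) R where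
  toFun u := g ((a + b) / 2 + (b - a) / 2 * u 0)
  invFun r := fun _ => (f r - (a + b) / 2) / ((b - a) / 2)
  source := Metric.ball 0 1
  target := g '' Ioo a b
  map_source' u hu := by
    rw [mem_ball_zero_iff, pi_norm_lt_iff one_pos] at hu
    have h0 := abs_lt.1 (hu 0)
    exact ⟨_, ⟨by nlinarith, by nlinarith⟩, rfl⟩
  map_target' := by
    rintro _ ⟨t, ht, rfl⟩
    rw [mem_ball_zero_iff, pi_norm_lt_iff one_pos]
    intro i
    have h2 : 0 < (b - a) / 2 := by linarith
    rw [hg t ht, Real.norm_eq_abs, abs_lt, lt_div_iff₀ h2, div_lt_iff₀ h2]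
    constructor <;> linarith [ht.1, ht.2]
  left_inv' u hu := by
    rw [mem_ball_zero_iff, pi_norm_lt_iff one_pos] at hu
    have h0 := abs_lt.1 (hu 0)
    have h2 : 0 < (b - a) / 2 := by linarith
    funext i
    rw [hg _ ⟨by nlinarith, by nlinarith⟩, Subsingleton.elim i 0]
    have h3 : b - a ≠ 0 := (sub_pos.2 hab).ne'
    field_simp
    ring
  right_inv' := by
    rintro _ ⟨t, ht, rfl⟩
    have h2 : 0 < (b - a) / 2 := by linarith
    simp only [hg t ht]
    have h3 : b - a ≠ 0 := (sub_pos.2 hab).ne'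
    congr 1
    field_simp
    ring

lemma arcEquiv_image_closedBall {R : Type*} (f : R → ℝ) (g : ℝ → R) (a b : ℝ) (hab : a < b)
    (hg : ∀ t ∈ Ioo a b, f (g t) = t) :
    arcEquiv f g a b hab hg '' Metric.closedBall 0 1 = g '' Icc a b := by
  have h2 : 0 < (b - a) / 2 := by linarith
  apply Subset.antisymm
  · rintro _ ⟨u, hu, rfl⟩
    rw [mem_closedBall_zero_iff, pi_norm_le_iff_of_nonneg zero_le_one] at hu
    have h0 := abs_le.1 (hu 0)
    exact ⟨_, ⟨by nlinarith, by nlinarith⟩, rfl⟩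
  · rintro _ ⟨t, ht, rfl⟩
    refine ⟨fun _ => (t - (a + b) / 2) / ((b - a) / 2), ?_, ?_⟩
    · rw [mem_closedBall_zero_iff, pi_norm_le_iff_of_nonneg zero_le_one]
      intro i
      rw [Real.norm_eq_abs, abs_le, le_div_iff₀ h2, div_le_iff₀ h2]
      constructor <;> linarith [ht.1, ht.2]
    · change g _ = g t
      have h3 : b - a ≠ 0 := (sub_pos.2 hab).ne'
      congr 1
      field_simp
      ring

lemma arcEquiv_image_ball {R : Type*} (f : R → ℝ) (g : ℝ → R) (a b : ℝ) (hab : a < b)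
    (hg : ∀ t ∈ Ioo a b, f (g t) = t) :
    arcEquiv f g a b hab hg '' Metric.ball 0 1 = g '' Ioo a b :=
  (arcEquiv f g a b hab hg).image_source_eq_target

lemma continuousOn_arcEquiv {R : Type*} [TopologicalSpace R] (f : R → ℝ) (g : ℝ → R) (a b : ℝ)
    (hab : a < b) (hg : ∀ t ∈ Ioo a b, f (g t) = t) (hc : ContinuousOn g (Icc a b)) :
    ContinuousOn (arcEquiv f g a b hab hg) (Metric.closedBall 0 1) := by
  refine hc.comp (f := fun u : Fin 1 → ℝ => (a + b) / 2 + (b - a) / 2 * u 0)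
    (by fun_prop) ?_
  intro u hu
  rw [mem_closedBall_zero_iff, pi_norm_le_iff_of_nonneg zero_le_one] at hu
  have h0 := abs_le.1 (hu 0)
  exact ⟨by nlinarith, by nlinarith⟩

lemma mapsTo_arcEquiv_sphere {R : Type*} (f : R → ℝ) (g : ℝ → R) (a b : ℝ)
    (hab : a < b) (hg : ∀ t ∈ Ioo a b, f (g t) = t) :
    MapsTo (arcEquiv f g a b hab hg) (Metric.sphere 0 1) {g a, g b} := by
  intro u hu
  have hu' : |u 0| = 1 := by
    rw [mem_sphere_zero_iff_norm] at hu
    simpa [Pi.norm_def, Finset.univ_unique] using hu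
  change g _ = g a ∨ g _ = g b
  rcases eq_or_eq_neg_of_abs_eq hu' with h | h
  · right; congr 1; rw [h]; ring
  · left; congr 1; rw [h]; ring

/-- A Hausdorff space assembled, with the weak topology, from a set `V` of vertices and a family
of arcs on each of which the continuous function `f` is a coordinate is a one-dimensional CW
complex. -/
theorem isOneDimCW_of_arcs {R : Type} [TopologicalSpace R] [T2Space R] (f : R → ℝ)
    (hf : Continuous f) (V : Set R) {ι : Type} [Nonempty ι] (a b : ι → ℝ) (g : ι → ℝ → R)
    (hab : ∀ i, a i < b i) (hg : ∀ i, ContinuousOn (g i) (Icc (a i) (b i)))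
    (hfg : ∀ i, ∀ t ∈ Ioo (a i) (b i), f (g i t) = t)
    (hga : ∀ i, g i (a i) ∈ V) (hgb : ∀ i, g i (b i) ∈ V)
    (hgV : ∀ i, ∀ t ∈ Ioo (a i) (b i), g i t ∉ V)
    (hdisj : ∀ i j, i ≠ j → Disjoint (g i '' Ioo (a i) (b i)) (g j '' Ioo (a j) (b j)))
    (hcover : ∀ r, r ∉ V → ∃ i, r ∈ g i '' Icc (a i) (b i))
    (hweak : ∀ A : Set R, (∀ i, IsClosed (A ∩ g i '' Icc (a i) (b i))) → IsClosed A) :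
    IsOneDimCW R := by
  classical
  let cw : CWComplex (univ : Set R) :=
    { cell := fun n => match n with
        | 0 => V
        | 1 => ι
        | (_ + 2) => PEmpty
      map := fun n i => match n, i with
        | 0, v => PartialEquiv.single ![] (v : R)
        | 1, i => arcEquiv f (g i) (a i) (b i) (hab i) (hfg i)
      source_eq := fun n i => match n, i with
        | 0, v => by
          ext x
          simp [Subsingleton.elim x ![]]
        | 1, i => rfl
      continuousOn := fun n i => match n, i with
        | 0, v => by
          have : Subsingleton (Fin 0 → ℝ) := inferInstance
          exact (continuous_of_const fun x y => by rw [Subsingleton.elim x y]).continuousOn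
        | 1, i => continuousOn_arcEquiv _ _ _ _ _ _ (hg i)
      continuousOn_symm := fun n i => match n, i with
        | 0, v => (continuous_of_const fun x y => Subsingleton.elim _ _).continuousOn
        | 1, i => Continuous.continuousOn (continuous_pi fun _ =>
            (hf.sub continuous_const).div_const _)
      pairwiseDisjoint' := by
        have key : ∀ (v : R), v ∈ V → ∀ i, Disjoint
            ((PartialEquiv.single ![] v : PartialEquiv (Fin 0 → ℝ) R) '' Metric.ball 0 1)
            (arcEquiv f (g i) (a i) (b i) (hab i) (hfg i) '' Metric.ball 0 1) := by
          intro v hv i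
          rw [arcEquiv_image_ball, Set.disjoint_left]
          rintro _ ⟨x, _, rfl⟩ ⟨t, ht, h⟩
          exact hgV i t ht (h ▸ hv)
        rintro ⟨n, i⟩ - ⟨n', j⟩ - hne
        match n, i, n', j with
        | 0, v, 0, w =>
          rw [Function.onFun, Set.disjoint_left]
          rintro _ ⟨x, _, rfl⟩ ⟨y, _, h⟩
          apply hne
          have : (w : R) = v := h
          rw [Subtype.ext this]
        | 0, v, 1, j => exact key v v.2 j
        | 1, i, 0, w => exact (key w w.2 i).symm
        | 1, i, 1, j =>
          have hij : i ≠ j := fun h => hne (by rw [h])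
          have := hdisj i j hij
          rw [← arcEquiv_image_ball f (g i) (a i) (b i) (hab i) (hfg i),
            ← arcEquiv_image_ball f (g j) (a j) (b j) (hab j) (hfg j)] at this
          exact this
      mapsTo' := fun n i => match n, i with
        | 0, v => ⟨fun _ => ∅, by simp [Metric.sphere_eq_empty_of_subsingleton]⟩
        | 1, i => by
          refine ⟨fun n => match n with
            | 0 => {⟨_, hga i⟩, ⟨_, hgb i⟩}
            | (_ + 1) => ∅, ?_⟩
          refine (mapsTo_arcEquiv_sphere _ _ _ _ _ _).mono_right ?_
          rintro r hr
          simp only [mem_iUnion]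
          have hz : (![] : Fin 0 → ℝ) ∈ Metric.closedBall (0 : Fin 0 → ℝ) 1 := by
            rw [Subsingleton.elim ![] (0 : Fin 0 → ℝ)]
            exact Metric.mem_closedBall_self zero_le_one
          rcases hr with rfl | rfl
          · exact ⟨0, zero_lt_one, ⟨_, hga i⟩, by simp, ![], hz, rfl⟩
          · exact ⟨0, zero_lt_one, ⟨_, hgb i⟩, by simp, ![], hz, rfl⟩
      -- Testing against the arcs is enough: intersections with single vertices are closed in any
      -- case.
      closed' := by
        intro A _ h
        refine hweak A fun i => ?_
        have := h 1 i
        rwa [← arcEquiv_image_closedBall f (g i) (a i) (b i) (hab i) (hfg i)]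
      union' := by
        refine eq_univ_of_forall fun r => ?_
        simp only [mem_iUnion]
        by_cases hr : r ∈ V
        · refine ⟨0, ⟨r, hr⟩, ![], ?_, rfl⟩
          rw [Subsingleton.elim ![] (0 : Fin 0 → ℝ)]
          exact Metric.mem_closedBall_self zero_le_one
        · obtain ⟨i, hi⟩ := hcover r hr
          rw [← arcEquiv_image_closedBall f (g i) (a i) (b i) (hab i) (hfg i)] at hi
          exact ⟨1, i, hi⟩ }
  refine ⟨inferInstance, cw, ‹Nonempty ι›, ?_⟩
  intro n hn
  match n, hn with
  | (n + 2), _ => exact (inferInstance : IsEmpty PEmpty)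

/-! ### Sections of a function on a space and one-dimensional cell structures -/

section Sections

variable {R : Type} [TopologicalSpace R]

/-- `s` is a continuous section of `f` over `I` whose values avoid `V`. -/
structure IsSectionOn (f : R → ℝ) (V : Set R) (s : ℝ → R) (I : Set ℝ) : Prop where
  continuousOn : ContinuousOn s I
  right_inv : ∀ t ∈ I, f (s t) = t
  notMem : ∀ t ∈ I, s t ∉ V

/-- `s` is a section over the open interval from `a` to `b` which starts at the point `v`, lying
over one of the two ends of the interval. -/
structure IsBranchAt (f : R → ℝ) (V : Set R) (v : R) (s : ℝ → R) (a b : ℝ) : Prop where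
  lt : a < b
  endpoint : f v = a ∨ f v = b
  isSectionOn : IsSectionOn f V s (Ioo a b)
  tendsto : Filter.Tendsto s (𝓝[Ioo a b] f v) (𝓝 v)

/-- Outside `V` the continuous function `f` is a local homeomorphism. -/
structure HasCharts (f : R → ℝ) (V : Set R) : Prop where
  continuous : Continuous f
  chart : ∀ w, w ∉ V → ∃ s : ℝ → R, ∃ δ > 0, IsSectionOn f V s (Ioo (f w - δ) (f w + δ)) ∧
    s (f w) = w ∧ IsOpen (s '' Ioo (f w - δ) (f w + δ))

/-- Outside `V` the function `f` is a local homeomorphism, and a set is a neighbourhood of a point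
of `V` as soon as it contains the beginning of each branch starting at this point. -/
structure IsGraphLike (f : R → ℝ) (V : Set R) : Prop extends HasCharts f V where
  nhds_of_branches : ∀ v ∈ V, ∀ U : Set R, v ∈ U →
    (∀ (a b : ℝ) (s : ℝ → R), IsBranchAt f V v s a b → ∀ᶠ t in 𝓝[Ioo a b] f v, s t ∈ U) →
      U ∈ 𝓝 v

variable {f : R → ℝ} {V : Set R} {s s' : ℝ → R} {I J : Set ℝ} {a b a' b' t : ℝ} {w w' : R}

lemma IsSectionOn.mono (h : IsSectionOn f V s I) (hJ : J ⊆ I) : IsSectionOn f V s J :=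
  ⟨h.continuousOn.mono hJ, fun t ht => h.right_inv t (hJ ht), fun t ht => h.notMem t (hJ ht)⟩

/-- By continuity `s x` stays in the open image of `s'`, and applying `f` shows that it can only be
the value of `s'` at `x` itself. -/
lemma IsSectionOn.eventuallyEq_of_isOpen_image (hs : IsSectionOn f V s I) (hI : I ∈ 𝓝 t)
    (hs' : IsSectionOn f V s' J) (ht : t ∈ J) (hJ : IsOpen (s' '' J)) (h : s t = s' t) :
    s =ᶠ[𝓝 t] s' := by
  have h1 : ∀ᶠ x in 𝓝 t, s x ∈ s' '' J :=
    (hs.continuousOn.continuousAt hI).eventually (hJ.mem_nhds (h ▸ mem_image_of_mem s' ht))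
  filter_upwards [h1, hI] with x hx hxI
  obtain ⟨y, hy, hyx⟩ := hx
  have : y = x := by rw [← hs'.right_inv y hy, hyx, hs.right_inv x hxI]
  rw [← hyx, this]

lemma HasCharts.isOpen_image (hG : HasCharts f V) (hs : IsSectionOn f V s I) (hI : IsOpen I) :
    IsOpen (s '' I) := by
  rw [isOpen_iff_mem_nhds]
  rintro _ ⟨t, ht, rfl⟩
  obtain ⟨σ, δ, hδ, hσ, hσt, ho⟩ := hG.chart (s t) (hs.notMem t ht)
  rw [hs.right_inv t ht] at hσ hσt ho
  have htJ : t ∈ Ioo (t - δ) (t + δ) := ⟨by linarith, by linarith⟩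
  have heq := hs.eventuallyEq_of_isOpen_image (hI.mem_nhds ht) hσ htJ ho hσt.symm
  have h1 : ∀ᶠ r in 𝓝 (s t), r ∈ σ '' Ioo (t - δ) (t + δ) :=
    ho.mem_nhds (hσt ▸ mem_image_of_mem σ htJ)
  have h2 : ∀ᶠ r in 𝓝 (s t), f r ∈ I ∧ s (f r) = σ (f r) := by
    have : Filter.Tendsto f (𝓝 (s t)) (𝓝 t) := by
      simpa [hs.right_inv t ht] using hG.continuous.tendsto (s t)
    exact this.eventually ((hI.eventually_mem ht).and heq)
  filter_upwards [h1, h2] with r hr1 hr2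
  obtain ⟨x, hx, rfl⟩ := hr1
  rw [hσ.right_inv x hx] at hr2
  exact ⟨x, hr2.1, hr2.2⟩

/-- The condition at the vertices can be checked in a space of which `R` is a quotient. -/
lemma HasCharts.isGraphLike_of_isQuotientMap (hC : HasCharts f V) {Y : Type*} [TopologicalSpace Y]
    {q : Y → R} (hq : IsQuotientMap q)
    (h : ∀ y, q y ∈ V → ∀ U : Set R, q y ∈ U →
      (∀ (a b : ℝ) (s : ℝ → R), IsBranchAt f V (q y) s a b → ∀ᶠ t in 𝓝[Ioo a b] f (q y), s t ∈ U) →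
      q ⁻¹' U ∈ 𝓝 y) : IsGraphLike f V := by
  refine ⟨hC, fun v hv U hvU hbr => ?_⟩
  -- The branch condition survives shrinking `U` to `v` and its interior, because sections have open
  -- images. The smaller set can then be shown open by looking at its preimage.
  have hbr' : ∀ (a b : ℝ) (s : ℝ → R), IsBranchAt f V v s a b →
      ∀ᶠ t in 𝓝[Ioo a b] f v, s t ∈ insert v (interior U) := by
    intro a b s hs
    obtain ⟨N, hNU, hN, hvN⟩ :=
      eventually_nhds_iff.1 (eventually_nhdsWithin_iff.1 (hbr a b s hs))
    have ho := hC.isOpen_image (hs.isSectionOn.mono (inter_subset_right (s := N)))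
      (hN.inter isOpen_Ioo)
    have hsub : s '' (N ∩ Ioo a b) ⊆ interior U := by
      refine interior_maximal ?_ ho
      rintro _ ⟨t, ht, rfl⟩
      exact hNU t ht.1 ht.2
    filter_upwards [self_mem_nhdsWithin, nhdsWithin_le_nhds (hN.mem_nhds hvN)] with t h1 h2
    exact Or.inr (hsub ⟨t, ⟨h2, h1⟩, rfl⟩)
  have hopen : IsOpen (insert v (interior U)) := by
    rw [← hq.isOpen_preimage, isOpen_iff_mem_nhds]
    intro y hy
    by_cases hyv : q y = v
    · subst hyv
      exact h y hv _ hy hbr'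
    · have hyU : q y ∈ interior U := hy.resolve_left hyv
      exact Filter.mem_of_superset ((isOpen_interior.preimage hq.continuous).mem_nhds hyU)
        (preimage_mono (subset_insert _ _))
  exact Filter.mem_of_superset (hopen.mem_nhds (mem_insert _ _))
    (insert_subset hvU interior_subset)

lemma IsGraphLike.eventuallyEq (hG : IsGraphLike f V) (hs : IsSectionOn f V s I) (hI : IsOpen I)
    (hs' : IsSectionOn f V s' J) (hJ : IsOpen J) (htI : t ∈ I) (htJ : t ∈ J) (h : s t = s' t) :
    s =ᶠ[𝓝 t] s' :=
  hs.eventuallyEq_of_isOpen_image (hI.mem_nhds htI) hs' htJ (hG.isOpen_image hs' hJ) h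

lemma IsGraphLike.eqOn [T2Space R] (hG : IsGraphLike f V) (hs : IsSectionOn f V s I)
    (hs' : IsSectionOn f V s' I) (hI : IsOpen I) (hI' : IsPreconnected I) (ht : t ∈ I)
    (h : s t = s' t) : EqOn s s' I := by
  have ho : IsOpen {x ∈ I | s x = s' x} := by
    rw [isOpen_iff_mem_nhds]
    rintro x ⟨hx, hxe⟩
    filter_upwards [hI.mem_nhds hx, hG.eventuallyEq hs hI hs' hI hx hx hxe] with y hy1 hy2
    exact ⟨hy1, hy2⟩
  have := hI'.subset_of_closure_inter_subset ho ⟨t, ht, ht, h⟩ (by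
    rintro x ⟨hx, hxI⟩
    refine ⟨hxI, ?_⟩
    have hne : (𝓝[{x ∈ I | s x = s' x}] x).NeBot := mem_closure_iff_nhdsWithin_neBot.1 hx
    have h1 : Filter.Tendsto s (𝓝[{x ∈ I | s x = s' x}] x) (𝓝 (s x)) :=
      (hs.continuousOn.continuousAt (hI.mem_nhds hxI)).tendsto.mono_left nhdsWithin_le_nhds
    have h2 : Filter.Tendsto s' (𝓝[{x ∈ I | s x = s' x}] x) (𝓝 (s' x)) :=
      (hs'.continuousOn.continuousAt (hI.mem_nhds hxI)).tendsto.mono_left nhdsWithin_le_nhds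
    refine tendsto_nhds_unique_of_eventuallyEq h1 h2 ?_
    filter_upwards [self_mem_nhdsWithin] with y hy using hy.2)
  exact fun x hx => (this hx).2

/-- The points which can be joined to `w` by a section of `f` avoiding `V`. -/
def edgeThrough (f : R → ℝ) (V : Set R) (w : R) : Set R :=
  {w' | ∃ s a b, IsSectionOn f V s (Ioo a b) ∧ f w ∈ Ioo a b ∧ f w' ∈ Ioo a b ∧
    s (f w) = w ∧ s (f w') = w'}

lemma edgeThrough_comm : w' ∈ edgeThrough f V w ↔ w ∈ edgeThrough f V w' := by
  constructor <;> rintro ⟨s, a, b, h, h1, h2, h3, h4⟩ <;> exact ⟨s, a, b, h, h2, h1, h4, h3⟩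

lemma IsGraphLike.mem_edgeThrough_self (hG : IsGraphLike f V) (hw : w ∉ V) :
    w ∈ edgeThrough f V w := by
  obtain ⟨s, δ, hδ, hs, hsw, -⟩ := hG.chart w hw
  have : f w ∈ Ioo (f w - δ) (f w + δ) := ⟨by linarith, by linarith⟩
  exact ⟨s, _, _, hs, this, this, hsw, hsw⟩

lemma disjoint_edgeThrough : Disjoint (edgeThrough f V w) V := by
  rw [Set.disjoint_left]
  rintro w' ⟨s, a, b, h, -, h2, -, h4⟩
  exact h4 ▸ h.notMem _ h2

/-- Sections that agree at a common point of two intervals extend to the union. -/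
lemma IsGraphLike.exists_union [T2Space R] (hG : IsGraphLike f V)
    (hs : IsSectionOn f V s (Ioo a b)) (hs' : IsSectionOn f V s' (Ioo a' b'))
    (ht : t ∈ Ioo a b) (ht' : t ∈ Ioo a' b') (h : s t = s' t) :
    ∃ σ, IsSectionOn f V σ (Ioo (min a a') (max b b')) ∧ EqOn σ s (Ioo a b) ∧
      EqOn σ s' (Ioo a' b') := by
  classical
  have hov : EqOn s s' (Ioo a b ∩ Ioo a' b') := by
    refine hG.eqOn (hs.mono inter_subset_left) (hs'.mono inter_subset_right)
      (isOpen_Ioo.inter isOpen_Ioo) ?_ ⟨ht, ht'⟩ h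
    rw [Ioo_inter_Ioo]
    exact isPreconnected_Ioo
  let σ : ℝ → R := fun x => if x ∈ Ioo a b then s x else s' x
  have h1 : EqOn σ s (Ioo a b) := fun x hx => if_pos hx
  have h2 : EqOn σ s' (Ioo a' b') := by
    intro x hx
    by_cases hx' : x ∈ Ioo a b
    · exact (h1 hx').trans (hov ⟨hx', hx⟩)
    · exact if_neg hx'
  have hcov : Ioo (min a a') (max b b') ⊆ Ioo a b ∪ Ioo a' b' := by
    intro x hx
    rcases le_total t x with hle | hle
    · rcases lt_max_iff.1 hx.2 with h | h
      · exact Or.inl ⟨ht.1.trans_le hle, h⟩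
      · exact Or.inr ⟨ht'.1.trans_le hle, h⟩
    · rcases min_lt_iff.1 hx.1 with h | h
      · exact Or.inl ⟨h, hle.trans_lt ht.2⟩
      · exact Or.inr ⟨h, hle.trans_lt ht'.2⟩
  refine ⟨σ, ⟨?_, ?_, ?_⟩, h1, h2⟩
  · intro x hx
    refine ContinuousAt.continuousWithinAt ?_
    rcases hcov hx with hx | hx
    · exact (hs.continuousOn.continuousAt (isOpen_Ioo.mem_nhds hx)).congr
        (Filter.eventuallyEq_of_mem (isOpen_Ioo.mem_nhds hx) h1).symm
    · exact (hs'.continuousOn.continuousAt (isOpen_Ioo.mem_nhds hx)).congr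
        (Filter.eventuallyEq_of_mem (isOpen_Ioo.mem_nhds hx) h2).symm
  · intro x hx
    rcases hcov hx with hx | hx
    · rw [h1 hx, hs.right_inv x hx]
    · rw [h2 hx, hs'.right_inv x hx]
  · intro x hx
    rcases hcov hx with hx | hx
    · rw [h1 hx]; exact hs.notMem x hx
    · rw [h2 hx]; exact hs'.notMem x hx

lemma IsGraphLike.edgeThrough_subset [T2Space R] (hG : IsGraphLike f V)
    (h : w' ∈ edgeThrough f V w) : edgeThrough f V w' ⊆ edgeThrough f V w := by
  obtain ⟨s, a, b, hs, h1, h2, h3, h4⟩ := h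
  rintro u ⟨s', a', b', hs', h1', h2', h3', h4'⟩
  obtain ⟨σ, hσ, e1, e2⟩ := hG.exists_union hs hs' h2 h1' (h4.trans h3'.symm)
  refine ⟨σ, _, _, hσ, ⟨min_lt_of_left_lt h1.1, lt_max_of_lt_left h1.2⟩,
    ⟨min_lt_of_right_lt h2'.1, lt_max_of_lt_right h2'.2⟩, ?_, ?_⟩
  · rw [e1 h1, h3]
  · rw [e2 h2', h4']

lemma IsGraphLike.edgeThrough_eq [T2Space R] (hG : IsGraphLike f V)
    (h : w' ∈ edgeThrough f V w) : edgeThrough f V w' = edgeThrough f V w :=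
  (hG.edgeThrough_subset h).antisymm (hG.edgeThrough_subset (edgeThrough_comm.1 h))

lemma IsSectionOn.image_subset_edgeThrough (hs : IsSectionOn f V s (Ioo a b))
    (ht : t ∈ Ioo a b) : s '' Ioo a b ⊆ edgeThrough f V (s t) := by
  rintro _ ⟨x, hx, rfl⟩
  refine ⟨s, a, b, hs, ?_, ?_, ?_, ?_⟩ <;>
    simp only [hs.right_inv t ht, hs.right_inv x hx] <;> assumption

lemma IsGraphLike.isOpen_edgeThrough [T2Space R] (hG : IsGraphLike f V) :
    IsOpen (edgeThrough f V w) := by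
  rw [isOpen_iff_mem_nhds]
  rintro w' ⟨s, a, b, hs, h1, h2, h3, h4⟩
  have := hs.image_subset_edgeThrough h1
  rw [h3] at this
  exact Filter.mem_of_superset ((hG.isOpen_image hs isOpen_Ioo).mem_nhds ⟨_, h2, h4⟩) this

lemma IsGraphLike.injOn_edgeThrough [T2Space R] (hG : IsGraphLike f V) :
    InjOn f (edgeThrough f V w) := by
  rintro u ⟨s, a, b, hs, h1, h2, h3, h4⟩ u' ⟨s', a', b', hs', h1', h2', h3', h4'⟩ he
  obtain ⟨σ, -, e1, e2⟩ := hG.exists_union hs hs' h1 h1' (h3.trans h3'.symm)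
  rw [← h4, ← h4', ← e1 h2, ← e2 h2', he]

lemma ordConnected_image_edgeThrough : (f '' edgeThrough f V w).OrdConnected := by
  refine ordConnected_of_uIcc_subset_left (x := f w) ?_
  rintro _ ⟨u, ⟨s, a, b, hs, h1, h2, h3, h4⟩, rfl⟩ t ht
  have htI := ordConnected_Ioo.uIcc_subset h1 h2 ht
  exact ⟨s t, ⟨s, a, b, hs, h1, by rwa [hs.right_inv t htI], h3, by rw [hs.right_inv t htI]⟩,
    hs.right_inv t htI⟩

lemma IsBranchAt.neBot {v : R} (h : IsBranchAt f V v s a b) : (𝓝[Ioo a b] f v).NeBot := by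
  rw [← mem_closure_iff_nhdsWithin_neBot, closure_Ioo h.lt.ne]
  rcases h.endpoint with h' | h' <;> rw [h']
  · exact left_mem_Icc.2 h.lt.le
  · exact right_mem_Icc.2 h.lt.le

/-- Edges are open and pairwise equal or disjoint, so a boundary point can only be a vertex. A
branch lies in a single edge; if no branch at `v` lay in this one, its complement would contain
every branch and be a neighbourhood of `v`. -/
lemma IsGraphLike.exists_branch [T2Space R] (hG : IsGraphLike f V) {v : R}
    (hv : v ∈ closure (edgeThrough f V w)) (hvE : v ∉ edgeThrough f V w) :
    v ∈ V ∧ ∃ s a b, IsBranchAt f V v s a b ∧ ∀ t ∈ Ioo a b, s t ∈ edgeThrough f V w := by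
  have hvV : v ∈ V := by
    by_contra hvV
    obtain ⟨u, hu1, hu2⟩ := mem_closure_iff.1 hv _ hG.isOpen_edgeThrough
      (hG.mem_edgeThrough_self hvV)
    apply hvE
    rw [← hG.edgeThrough_eq hu2, hG.edgeThrough_eq hu1]
    exact hG.mem_edgeThrough_self hvV
  refine ⟨hvV, ?_⟩
  by_contra! hcon
  have : (edgeThrough f V w)ᶜ ∈ 𝓝 v := by
    refine hG.nhds_of_branches v hvV _ hvE fun a b s hs => ?_
    filter_upwards [self_mem_nhdsWithin] with t ht htE
    obtain ⟨x, hx, hxE⟩ := hcon s a b hs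
    apply hxE
    rw [← hG.edgeThrough_eq htE]
    exact hs.isSectionOn.image_subset_edgeThrough ht ⟨x, hx, rfl⟩
  obtain ⟨u, hu1, hu2⟩ := mem_closure_iff_nhds.1 hv _ this
  exact hu1 hu2

lemma exists_section_of_mem_edgeThrough {u : R} (hu : u ∈ edgeThrough f V w) :
    ∃ s a b, IsSectionOn f V s (Ioo a b) ∧ f u ∈ Ioo a b ∧ s (f u) = u ∧
      ∀ t ∈ Ioo a b, s t ∈ edgeThrough f V w := by
  obtain ⟨s, a, b, hs, h1, h2, h3, h4⟩ := hu
  refine ⟨s, a, b, hs, h2, h4, fun t ht => ?_⟩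
  have := hs.image_subset_edgeThrough h1 ⟨t, ht, rfl⟩
  rwa [h3] at this

/-- Two points of the closed edge over one value are limits of sections inside the edge. Sections
over the same side agree by injectivity on the edge, so their limits agree. This excludes loops: a
closed edge is an interval. -/
lemma IsGraphLike.injOn_closure_edgeThrough [T2Space R] (hG : IsGraphLike f V) :
    InjOn f (closure (edgeThrough f V w)) := by
  set E := edgeThrough f V w with hE
  have key : ∀ u ∈ E, ∀ v ∈ closure E, v ∉ E → f u ≠ f v := by
    intro u hu v hv hvE he
    obtain ⟨hvV, s, a, b, hs, hsE⟩ := hG.exists_branch hv hvE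
    obtain ⟨σ, a', b', hσ, huI, hσu, hσE⟩ := exists_section_of_mem_edgeThrough hu
    rw [he] at hσu huI
    have := hs.neBot
    have h1 : Filter.Tendsto σ (𝓝[Ioo a b] f v) (𝓝 u) := by
      have := (hσ.continuousOn.continuousAt (isOpen_Ioo.mem_nhds huI)).tendsto
      rw [hσu] at this
      exact this.mono_left nhdsWithin_le_nhds
    have : v = u := by
      refine tendsto_nhds_unique_of_eventuallyEq hs.tendsto h1 ?_
      filter_upwards [self_mem_nhdsWithin, nhdsWithin_le_nhds (isOpen_Ioo.mem_nhds huI)] with t h2 h3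
      refine hG.injOn_edgeThrough (hsE t h2) (hσE t h3) ?_
      rw [hs.isSectionOn.right_inv t h2, hσ.right_inv t h3]
    exact hvE (this ▸ hu)
  intro u hu v hv he
  by_cases huE : u ∈ E
  · by_cases hvE : v ∈ E
    · exact hG.injOn_edgeThrough huE hvE he
    · exact absurd he (key u huE v hv hvE)
  by_cases hvE : v ∈ E
  · exact absurd he.symm (key v hvE u hu huE)
  obtain ⟨huV, s, a, b, hs, hsE⟩ := hG.exists_branch hu huE
  obtain ⟨hvV, s', a', b', hs', hsE'⟩ := hG.exists_branch hv hvE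
  have hnot : f u ∉ f '' E := by
    rintro ⟨x, hx, hxu⟩
    exact key x hx u hu huE hxu
  -- Branches on opposite sides of `f u` would force the edge, whose image is an interval, to pass
  -- over `f u`. So both branches start on the same side.
  have hside : ∀ x ∈ Ioo a b, ∀ y ∈ Ioo a' b', f u ∉ uIcc x y := by
    intro x hx y hy hxy
    exact hnot (ordConnected_image_edgeThrough.uIcc_subset
      ⟨_, hsE x hx, hs.isSectionOn.right_inv x hx⟩
      ⟨_, hsE' y hy, hs'.isSectionOn.right_inv y hy⟩ hxy)
  obtain ⟨x, hx⟩ := exists_between hs.lt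
  obtain ⟨y, hy⟩ := exists_between hs'.lt
  have hsxy := hside x hx y hy
  have hmem : Ioo a' b' ∈ 𝓝[Ioo a b] f u := by
    rw [mem_uIcc, not_or, not_and, not_and] at hsxy
    have e1 := hs.endpoint
    have e2 := hs'.endpoint
    rw [← he] at e2
    rcases e1 with e1 | e1 <;> rcases e2 with e2 | e2
    · filter_upwards [self_mem_nhdsWithin,
        nhdsWithin_le_nhds (Iio_mem_nhds (show f u < b' by linarith [hs'.lt]))] with t h1 h2
      exact ⟨by linarith [h1.1], h2⟩
    · exact absurd (show f u ≤ x by linarith [hx.1]) (hsxy.2 (by linarith [hy.2]))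
    · exact absurd (show f u ≤ y by linarith [hy.1]) (hsxy.1 (by linarith [hx.2]))
    · filter_upwards [self_mem_nhdsWithin,
        nhdsWithin_le_nhds (Ioi_mem_nhds (show a' < f u by linarith [hs'.lt]))] with t h1 h2
      exact ⟨h2, by linarith [h1.2]⟩
  have := hs.neBot
  have hlim : Filter.Tendsto s' (𝓝[Ioo a b] f u) (𝓝 v) := by
    refine hs'.tendsto.mono_left ?_
    rw [← he]
    exact nhdsWithin_le_iff.2 hmem
  refine tendsto_nhds_unique_of_eventuallyEq hs.tendsto hlim ?_
  filter_upwards [self_mem_nhdsWithin, hmem] with t h2 h3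
  refine hG.injOn_edgeThrough (hsE t h2) (hsE' t h3) ?_
  rw [hs.isSectionOn.right_inv t h2, hs'.isSectionOn.right_inv t h3]

/-- The points of `V` in the closure of an edge lie over the ends of the interval over which the
edge lies. -/
lemma IsGraphLike.le_or_ge_of_mem_closure [T2Space R] (hG : IsGraphLike f V) (hw : w ∉ V) {v : R}
    (hv : v ∈ closure (edgeThrough f V w)) (hvE : v ∉ edgeThrough f V w) :
    (∀ x ∈ f '' closure (edgeThrough f V w), x ≤ f v) ∨
      ∀ x ∈ f '' closure (edgeThrough f V w), f v ≤ x := by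
  have hnot : f v ∉ f '' edgeThrough f V w := by
    rintro ⟨u, hu, huv⟩
    exact hvE (hG.injOn_closure_edgeThrough (subset_closure hu) hv huv ▸ hu)
  have hcl : f '' closure (edgeThrough f V w) ⊆ closure (f '' edgeThrough f V w) :=
    image_closure_subset_closure_image hG.continuous
  have hwE : f w ∈ f '' edgeThrough f V w := ⟨w, hG.mem_edgeThrough_self hw, rfl⟩
  rcases le_total (f w) (f v) with hle | hle
  · left
    refine fun x hx => closure_minimal (t := Iic (f v)) ?_ isClosed_Iic (hcl hx)
    intro y hy
    by_contra hlt
    exact hnot (ordConnected_image_edgeThrough.out hwE hy ⟨hle, (not_le.1 hlt).le⟩)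
  · right
    refine fun x hx => closure_minimal (t := Ici (f v)) ?_ isClosed_Ici (hcl hx)
    intro y hy
    by_contra hlt
    exact hnot (ordConnected_image_edgeThrough.out hy hwE ⟨(not_le.1 hlt).le, hle⟩)

lemma IsGraphLike.ordConnected_image_closure [T2Space R] (hG : IsGraphLike f V) :
    (f '' closure (edgeThrough f V w)).OrdConnected := by
  rw [← isPreconnected_iff_ordConnected]
  exact (isPreconnected_iff_ordConnected.2 ordConnected_image_edgeThrough).subset_closure
    (image_mono subset_closure) (image_closure_subset_closure_image hG.continuous)

/-- The interval over which a branch lies is all of the closed edge near the start of the branch. -/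
lemma IsGraphLike.insert_mem_nhdsWithin [T2Space R] (hG : IsGraphLike f V) (hw : w ∉ V) {v : R}
    (hs : IsBranchAt f V v s a b) (hsE : ∀ t ∈ Ioo a b, s t ∈ edgeThrough f V w)
    (hv : v ∈ closure (edgeThrough f V w)) (hvE : v ∉ edgeThrough f V w) :
    insert (f v) (Ioo a b) ∈ 𝓝[f '' closure (edgeThrough f V w)] f v := by
  obtain ⟨x, hx⟩ := exists_between hs.lt
  have hxJ : x ∈ f '' closure (edgeThrough f V w) :=
    ⟨s x, subset_closure (hsE x hx), hs.isSectionOn.right_inv x hx⟩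
  rcases hs.endpoint with e | e
  · have hmin : ∀ x ∈ f '' closure (edgeThrough f V w), f v ≤ x := by
      rcases hG.le_or_ge_of_mem_closure hw hv hvE with h | h
      · exact absurd (h x hxJ) (by rw [e]; exact not_le.2 hx.1)
      · exact h
    filter_upwards [self_mem_nhdsWithin,
      nhdsWithin_le_nhds (Iio_mem_nhds (show f v < b by linarith [hs.lt]))] with t h1 h2
    rcases (hmin t h1).eq_or_lt with h | h
    · exact Or.inl h.symm
    · exact Or.inr ⟨e ▸ h, h2⟩
  · have hmax : ∀ x ∈ f '' closure (edgeThrough f V w), x ≤ f v := by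
      rcases hG.le_or_ge_of_mem_closure hw hv hvE with h | h
      · exact h
      · exact absurd (h x hxJ) (by rw [e]; exact not_le.2 hx.2)
    filter_upwards [self_mem_nhdsWithin,
      nhdsWithin_le_nhds (Ioi_mem_nhds (show a < f v by linarith [hs.lt]))] with t h1 h2
    rcases (hmax t h1).eq_or_lt with h | h
    · exact Or.inl h
    · exact Or.inr ⟨h2, e ▸ h⟩

/-- The inverse of `f` on the closed edge is continuous: it coincides with a local section at
interior points and with a branch near an end. -/
lemma IsGraphLike.exists_closed_edge_section [T2Space R] (hG : IsGraphLike f V) (hw : w ∉ V) :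
    ∃ g : ℝ → R, ContinuousOn g (f '' closure (edgeThrough f V w)) ∧
      ∀ u ∈ closure (edgeThrough f V w), g (f u) = u := by
  have : Nonempty R := ⟨w⟩
  set E := edgeThrough f V w with hE
  have hinj := hG.injOn_closure_edgeThrough (w := w)
  have hg : ∀ u ∈ closure E, Function.invFunOn f (closure E) (f u) = u :=
    fun u hu => hinj.leftInvOn_invFunOn hu
  refine ⟨Function.invFunOn f (closure E), ?_, hg⟩
  rintro _ ⟨u, hu, rfl⟩
  by_cases huE : u ∈ E
  · obtain ⟨σ, a, b, hσ, huI, hσu, hσE⟩ := exists_section_of_mem_edgeThrough huE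
    refine ((hσ.continuousOn.continuousAt (isOpen_Ioo.mem_nhds huI)).congr ?_).continuousWithinAt
    filter_upwards [isOpen_Ioo.mem_nhds huI] with t ht
    have := hg _ (subset_closure (hσE t ht))
    rw [hσ.right_inv t ht] at this
    exact this.symm
  · obtain ⟨-, s, a, b, hs, hsE⟩ := hG.exists_branch hu huE
    refine ContinuousWithinAt.mono_of_mem_nhdsWithin ?_ (hG.insert_mem_nhdsWithin hw hs hsE hu huE)
    rw [continuousWithinAt_insert_self, ContinuousWithinAt, hg u hu]
    refine hs.tendsto.congr' ?_
    filter_upwards [self_mem_nhdsWithin] with t ht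
    have := hg _ (subset_closure (hsE t ht))
    rw [hs.isSectionOn.right_inv t ht] at this
    exact this.symm

end Sections

/-! ### Subdivision of edges into compact arcs and the CW structure -/

/-- Treats all types of intervals at once. An end contained in `J` is attained by the sequence,
which is constant from there on; this is why monotonicity is not strict. -/
lemma exists_monotone_int_seq {J : Set ℝ} (hJ : J.OrdConnected) (hne : J.Nonempty) :
    ∃ x : ℤ → ℝ, Monotone x ∧ (∀ n, x n ∈ J) ∧ (∀ t ∈ J, ∃ n, t ≤ x n) ∧ ∀ t ∈ J, ∃ n, x n ≤ t := by
  obtain ⟨t₀, ht₀⟩ := hne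
  have : Nonempty J := ⟨⟨t₀, ht₀⟩⟩
  have := hJ
  obtain ⟨u, hu, hutop⟩ := Filter.exists_seq_monotone_tendsto_atTop_atTop J
  obtain ⟨l, hl, hlbot⟩ := Filter.exists_seq_antitone_tendsto_atTop_atBot J
  have hmem : ∀ {y z : ℝ}, y ∈ J → z ∈ J → max y z ∈ J ∧ min y z ∈ J := by
    intro y z hy hz
    rcases le_total y z with h | h <;> simp [h, hy, hz]
  refine ⟨fun n => if 0 ≤ n then max t₀ (u n.toNat) else min t₀ (l (-n).toNat), ?_, ?_, ?_, ?_⟩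
  · intro m n hmn
    simp only
    split_ifs with h1 h2 h2
    · exact max_le_max le_rfl (hu (Int.toNat_le_toNat hmn))
    · omega
    · exact (min_le_left _ _).trans (le_max_left _ _)
    · exact min_le_min le_rfl (hl (Int.toNat_le_toNat (neg_le_neg hmn)))
  · intro n
    simp only
    split_ifs
    · exact (hmem ht₀ (u _).2).1
    · exact (hmem ht₀ (l _).2).2
  · intro t ht
    obtain ⟨n, hn⟩ := (hutop.eventually_ge_atTop ⟨t, ht⟩).exists
    refine ⟨n, ?_⟩
    simp only [Int.natCast_nonneg, if_true, Int.toNat_natCast]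
    exact le_max_of_le_right hn
  · intro t ht
    obtain ⟨n, hn⟩ := (hlbot.eventually_le_atBot ⟨t, ht⟩).exists
    -- The index `0` belongs to the upper half of the sequence, so the shift by one keeps the index
    -- negative; `l` is antitone, so nothing is lost.
    refine ⟨-(n + 1 : ℕ), ?_⟩
    have : ¬ (0 : ℤ) ≤ -((n + 1 : ℕ) : ℤ) := by push_cast; omega
    simp only [this, if_false, neg_neg, Int.toNat_natCast]
    exact min_le_of_right_le ((hl n.le_succ).trans hn)

section

variable {R : Type} [TopologicalSpace R] {f : R → ℝ} {V : Set R}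

/-- A locally finite subdivision of the closure of an edge. -/
lemma IsGraphLike.exists_subdivision [T2Space R] (hG : IsGraphLike f V) {w : R} (hw : w ∉ V) :
    ∃ (g : ℝ → R) (x : ℤ → ℝ), Monotone x ∧ (∃ n, x n < x (n + 1)) ∧
      (∀ m n, ContinuousOn g (Icc (x m) (x n))) ∧
      (∀ u ∈ edgeThrough f V w, g (f u) = u ∧ ∃ m n, x m < f u ∧ f u < x n) ∧
      (∀ m n, ∀ t ∈ Icc (x m) (x n), f (g t) = t) ∧
      (∀ m n, ∀ t ∈ Ioo (x m) (x n), g t ∈ edgeThrough f V w) ∧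
      (∀ n, g (x n) ∈ V ∨ g (x n) ∈ edgeThrough f V w) ∧
      ∀ v ∈ V, ∀ s a b, IsBranchAt f V v s a b → (∀ t ∈ Ioo a b, s t ∈ edgeThrough f V w) →
        ∃ m n, Icc (x m) (x n) ∈ 𝓝[Ioo a b] f v ∧ f v ∈ Icc (x m) (x n) ∧ g (f v) = v := by
  obtain ⟨g, hgc, hg⟩ := hG.exists_closed_edge_section hw
  set E := edgeThrough f V w with hE
  have hwE : w ∈ E := hG.mem_edgeThrough_self hw
  have hJ : (f '' closure E).OrdConnected := hG.ordConnected_image_closure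
  obtain ⟨x, hx, hxJ, htop, hbot⟩ := exists_monotone_int_seq hJ ⟨f w, w, subset_closure hwE, rfl⟩
  have hsub : ∀ m n, Icc (x m) (x n) ⊆ f '' closure E := fun m n => hJ.out (hxJ m) (hxJ n)
  have hfg : ∀ t ∈ f '' closure E, g t ∈ closure E ∧ f (g t) = t := by
    rintro _ ⟨u, hu, rfl⟩
    rw [hg u hu]
    exact ⟨hu, rfl⟩
  have hbetween : ∀ u ∈ E, ∃ m n, x m < f u ∧ f u < x n := by
    intro u hu
    obtain ⟨s, a, b, hs, huI, -, hsE⟩ := exists_section_of_mem_edgeThrough hu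
    obtain ⟨y, hy1, hy2⟩ := exists_between huI.1
    obtain ⟨z, hz1, hz2⟩ := exists_between huI.2
    have hyI : y ∈ Ioo a b := ⟨hy1, hy2.trans huI.2⟩
    have hzI : z ∈ Ioo a b := ⟨huI.1.trans hz1, hz2⟩
    obtain ⟨m, hm⟩ := hbot y ⟨s y, subset_closure (hsE y hyI), hs.right_inv y hyI⟩
    obtain ⟨n, hn⟩ := htop z ⟨s z, subset_closure (hsE z hzI), hs.right_inv z hzI⟩
    exact ⟨m, n, hm.trans_lt hy2, hz1.trans_le hn⟩
  refine ⟨g, x, hx, ?_, fun m n => hgc.mono (hsub m n),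
    fun u hu => ⟨hg u (subset_closure hu), hbetween u hu⟩,
    fun m n t ht => (hfg t (hsub m n ht)).2, ?_, ?_, ?_⟩
  · obtain ⟨m, n, h1, h2⟩ := hbetween w hwE
    by_contra! hcon
    exact absurd (h1.trans h2) (not_lt.2 (antitone_int_of_succ_le hcon
      (hx.reflect_lt (h1.trans h2)).le))
  · intro m n t ht
    by_contra hnot
    have hmem := hsub m n (Ioo_subset_Icc_self ht)
    have h2 := hG.le_or_ge_of_mem_closure hw (hfg t hmem).1 hnot
    rw [(hfg t hmem).2] at h2
    rcases h2 with h | h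
    · exact absurd (h _ (hxJ n)) (not_le.2 ht.2)
    · exact absurd (h _ (hxJ m)) (not_le.2 ht.1)
  · intro n
    by_cases h : g (x n) ∈ E
    · exact Or.inr h
    · exact Or.inl (hG.exists_branch (hfg _ (hxJ n)).1 h).1
  · intro v hv s a b hs hsE
    have hvE : v ∉ E := fun h => Set.disjoint_left.1 disjoint_edgeThrough h hv
    have := hs.neBot
    have hcl : v ∈ closure E := mem_closure_of_tendsto hs.tendsto
      (by filter_upwards [self_mem_nhdsWithin] with t ht using hsE t ht)
    obtain ⟨y, hy⟩ := exists_between hs.lt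
    have hyJ : y ∈ f '' closure E := ⟨s y, subset_closure (hsE y hy), hs.isSectionOn.right_inv y hy⟩
    have hvJ : f v ∈ f '' closure E := ⟨v, hcl, rfl⟩
    rcases hs.endpoint with e | e
    · obtain ⟨m, hm⟩ := hbot _ hvJ
      obtain ⟨n, hn⟩ := htop y hyJ
      refine ⟨m, n, ?_, ⟨hm, by linarith [hy.1]⟩, hg v hcl⟩
      filter_upwards [self_mem_nhdsWithin,
        nhdsWithin_le_nhds (Iio_mem_nhds (show f v < y by rw [e]; exact hy.1))] with t h1 h2
      have h2 : t < y := h2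
      exact ⟨by linarith [h1.1], by linarith⟩
    · obtain ⟨m, hm⟩ := hbot y hyJ
      obtain ⟨n, hn⟩ := htop _ hvJ
      refine ⟨m, n, ?_, ⟨by linarith [hy.2], hn⟩, hg v hcl⟩
      filter_upwards [self_mem_nhdsWithin,
        nhdsWithin_le_nhds (Ioi_mem_nhds (show y < f v by rw [e]; exact hy.2))] with t h1 h2
      have h2 : y < t := h2
      exact ⟨by linarith, by linarith [h1.2]⟩

/-- Steps of zero length give no cell, so a point has to be located in a nondegenerate one; `x m < x
n` ensures that there is such a step. -/
lemma exists_mem_Icc_int {x : ℤ → ℝ} {t : ℝ} {m n : ℤ} (h1 : x m ≤ t) (h2 : t ≤ x n)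
    (hx : Monotone x) (hmn : x m < x n) : ∃ k, x k < x (k + 1) ∧ t ∈ Icc (x k) (x (k + 1)) := by
  have key : ∀ d : ℕ, ∀ m, x m ≤ t → t ≤ x (m + d) → x m < x (m + d) →
      ∃ k, x k < x (k + 1) ∧ t ∈ Icc (x k) (x (k + 1)) := by
    intro d
    induction d with
    | zero => intro m _ _ h; simp at h
    | succ d ih =>
      intro m h1 h2 h3
      have e : m + ((d + 1 : ℕ) : ℤ) = (m + d) + 1 := by push_cast; ring
      rw [e] at h2 h3
      by_cases h : x (m + d) < x (m + d + 1)
      · by_cases h' : x (m + d) ≤ t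
        · exact ⟨_, h, h', h2⟩
        · exact ih m h1 (not_le.1 h').le (h1.trans_lt (not_le.1 h'))
      · have h' := not_lt.1 h
        exact ih m h1 (h2.trans h') (h3.trans_le h')
  have hlt : m ≤ n := (hx.reflect_lt hmn).le
  obtain ⟨d, rfl⟩ := Int.le.dest hlt
  exact key d m h1 h2 hmn

lemma isClosed_inter_image_Icc [T2Space R] {g : ℝ → R} {x : ℤ → ℝ} (hx : Monotone x) {A : Set R}
    (h : ∀ n, x n < x (n + 1) → IsClosed (A ∩ g '' Icc (x n) (x (n + 1)))) (m n : ℤ) :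
    IsClosed (A ∩ g '' Icc (x m) (x n)) := by
  have key : ∀ d : ℕ, IsClosed (A ∩ g '' Icc (x m) (x (m + d))) := by
    intro d
    induction d with
    | zero =>
      simp only [Nat.cast_zero, add_zero, Icc_self, image_singleton]
      exact ((Set.finite_singleton _).subset inter_subset_right).isClosed
    | succ d ih =>
      have e : m + ((d + 1 : ℕ) : ℤ) = (m + d) + 1 := by push_cast; ring
      rw [e, ← Icc_union_Icc_eq_Icc (hx (by omega : m ≤ m + d)) (hx (by omega : m + d ≤ m + d + 1)),
        image_union, inter_union_distrib_left]
      refine ih.union ?_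
      rcases (hx (by omega : m + (d : ℤ) ≤ m + d + 1)).lt_or_eq with hlt | heq
      · exact h _ hlt
      · rw [← heq, Icc_self, image_singleton]
        exact ((Set.finite_singleton _).subset inter_subset_right).isClosed
  rcases lt_or_ge (x n) (x m) with hlt | hle
  · rw [Icc_eq_empty (not_le.2 hlt)]
    simp
  rcases le_total m n with hmn | hmn
  · obtain ⟨d, rfl⟩ := Int.le.dest hmn
    exact key d
  · rw [le_antisymm (hx hmn) hle, Icc_self, image_singleton]
    exact ((Set.finite_singleton _).subset inter_subset_right).isClosed

/-- A Hausdorff space which is graph-like with respect to a continuous function is a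
one-dimensional CW complex, provided that it has points besides the vertices. -/
theorem IsGraphLike.isOneDimCW [T2Space R] (hG : IsGraphLike f V) (hV : ∃ w, w ∉ V) :
    IsOneDimCW R := by
  let ℰ : Type := {E : Set R // ∃ w, w ∉ V ∧ E = edgeThrough f V w}
  have hex : ∀ E : ℰ, ∃ (g : ℝ → R) (x : ℤ → ℝ), Monotone x ∧ (∃ n, x n < x (n + 1)) ∧
      (∀ m n, ContinuousOn g (Icc (x m) (x n))) ∧
      (∀ u ∈ E.1, g (f u) = u ∧ ∃ m n, x m < f u ∧ f u < x n) ∧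
      (∀ m n, ∀ t ∈ Icc (x m) (x n), f (g t) = t) ∧
      (∀ m n, ∀ t ∈ Ioo (x m) (x n), g t ∈ E.1) ∧
      (∀ n, g (x n) ∈ V ∨ g (x n) ∈ E.1) ∧
      ∀ v ∈ V, ∀ s a b, IsBranchAt f V v s a b → (∀ t ∈ Ioo a b, s t ∈ E.1) →
        ∃ m n, Icc (x m) (x n) ∈ 𝓝[Ioo a b] f v ∧ f v ∈ Icc (x m) (x n) ∧ g (f v) = v := by
    rintro ⟨_, w, hw, rfl⟩
    exact hG.exists_subdivision hw
  choose g x hx hstep hgc hE hfg hgE hgx hbr using hex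
  have hEV : ∀ E : ℰ, ∀ u ∈ E.1, u ∉ V := by
    rintro ⟨_, w, hw, rfl⟩ u hu
    exact Set.disjoint_left.1 disjoint_edgeThrough hu
  have hEeq : ∀ E E' : ℰ, ∀ u, u ∈ E.1 → u ∈ E'.1 → E = E' := by
    rintro ⟨_, w, hw, rfl⟩ ⟨_, w', hw', rfl⟩ u hu hu'
    apply Subtype.ext
    exact (hG.edgeThrough_eq hu).symm.trans (hG.edgeThrough_eq hu')
  have hEmem : ∀ u, u ∉ V → ∃ E : ℰ, u ∈ E.1 :=
    fun u hu => ⟨⟨_, u, hu, rfl⟩, hG.mem_edgeThrough_self hu⟩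
  have hEopen : ∀ E : ℰ, IsOpen E.1 := by
    rintro ⟨_, w, hw, rfl⟩
    exact hG.isOpen_edgeThrough
  -- The cells: one for each edge and each nondegenerate step of its subdivision.
  let ι : Type := {i : ℰ × ℤ // x i.1 i.2 < x i.1 (i.2 + 1)}
  obtain ⟨w, hw⟩ := hV
  have : Nonempty ι := by
    obtain ⟨E, -⟩ := hEmem w hw
    obtain ⟨n, hn⟩ := hstep E
    exact ⟨⟨(E, n), hn⟩⟩
  have hnotint : ∀ (E : ℰ) (n k : ℤ), x E k ∉ Ioo (x E n) (x E (n + 1)) := by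
    intro E n k hk
    have h1 := (hx E).reflect_lt hk.1
    have h2 := (hx E).reflect_lt hk.2
    omega
  refine isOneDimCW_of_arcs f hG.continuous (V ∪ {r | ∃ E n, r = g E (x E n)}) (ι := ι)
    (fun i => x i.1.1 i.1.2) (fun i => x i.1.1 (i.1.2 + 1)) (fun i => g i.1.1) (fun i => i.2)
    (fun i => hgc _ _ _) (fun i t ht => hfg _ _ _ t (Ioo_subset_Icc_self ht))
    (fun i => Or.inr ⟨_, _, rfl⟩) (fun i => Or.inr ⟨_, _, rfl⟩) ?_ ?_ ?_ ?_
  · rintro ⟨⟨E, n⟩, hn⟩ t ht (hV' | ⟨E', k, hk⟩)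
    · exact hEV E _ (hgE E _ _ t ht) hV'
    · have h1 := hgE E _ _ t ht
      simp only at hk
      rw [hk] at h1
      rcases hgx E' k with h2 | h2
      · exact hEV E _ h1 h2
      · obtain rfl := hEeq _ _ _ h1 h2
        have h3 := hfg E _ _ t (Ioo_subset_Icc_self ht)
        rw [hk, hfg E k k _ ⟨le_rfl, le_rfl⟩] at h3
        exact hnotint E n k (h3 ▸ ht)
  · rintro ⟨⟨E, n⟩, hn⟩ ⟨⟨E', n'⟩, hn'⟩ hne
    rw [Set.disjoint_left]
    rintro _ ⟨t, ht, rfl⟩ ⟨t', ht', h⟩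
    simp only at h ht ht'
    have h1 := hgE E _ _ t ht
    have h2 := hgE E' _ _ t' ht'
    rw [h] at h2
    obtain rfl := hEeq _ _ _ h1 h2
    have h3 := hfg E _ _ t (Ioo_subset_Icc_self ht)
    rw [← h, hfg E _ _ t' (Ioo_subset_Icc_self ht')] at h3
    subst h3
    apply hne
    have h4 := (hx E).reflect_lt (ht.1.trans ht'.2)
    have h5 := (hx E).reflect_lt (ht'.1.trans ht.2)
    have : n = n' := by omega
    subst this
    rfl
  · intro r hr
    obtain ⟨E, hrE⟩ := hEmem r fun h => hr (Or.inl h)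
    obtain ⟨hgr, m, n, hm, hn⟩ := hE E r hrE
    obtain ⟨k, hk, hkt⟩ := exists_mem_Icc_int hm.le hn.le (hx E) (hm.trans hn)
    exact ⟨⟨(E, k), hk⟩, f r, hkt, hgr⟩
  · intro A hA
    have hcl : ∀ (E : ℰ) m n, IsClosed (A ∩ g E '' Icc (x E m) (x E n)) := fun E =>
      isClosed_inter_image_Icc (hx E) fun n hn => hA ⟨(E, n), hn⟩
    rw [← isOpen_compl_iff, isOpen_iff_mem_nhds]
    intro r hr
    by_cases hrV : r ∈ V
    -- Each branch at a vertex stays in one edge, and its beginning is covered by finitely many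
    -- arcs, whose union meets `A` in a closed set. No uniformity over the branches is needed.
    · refine hG.nhds_of_branches r hrV _ hr fun a b s hs => ?_
      obtain ⟨y, hy⟩ := exists_between hs.lt
      obtain ⟨E, hyE⟩ := hEmem _ (hs.isSectionOn.notMem y hy)
      have hsE : ∀ t ∈ Ioo a b, s t ∈ E.1 := by
        obtain ⟨E', hE'⟩ : ∃ E' : ℰ, ∀ t ∈ Ioo a b, s t ∈ E'.1 :=
          ⟨⟨_, _, hs.isSectionOn.notMem y hy, rfl⟩, fun t ht =>
            hs.isSectionOn.image_subset_edgeThrough hy ⟨t, ht, rfl⟩⟩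
        rwa [hEeq _ _ _ hyE (hE' y hy)]
      obtain ⟨m, n, hnhds, hmem, hgr⟩ := hbr E r hrV s a b hs hsE
      have h1 : (A ∩ g E '' Icc (x E m) (x E n))ᶜ ∈ 𝓝 r :=
        (hcl E m n).isOpen_compl.mem_nhds fun h => hr h.1
      filter_upwards [self_mem_nhdsWithin, hnhds, hs.tendsto h1] with t ht1 ht2 ht3 htA
      have h2 := (hE E _ (hsE t ht1)).1
      rw [hs.isSectionOn.right_inv t ht1] at h2
      exact ht3 ⟨htA, t, ht2, h2⟩
    · obtain ⟨E, hrE⟩ := hEmem r hrV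
      obtain ⟨hgr, m, n, hm, hn⟩ := hE E r hrE
      have h1 : (A ∩ g E '' Icc (x E m) (x E n))ᶜ ∈ 𝓝 r :=
        (hcl E m n).isOpen_compl.mem_nhds fun h => hr h.1
      filter_upwards [h1, (hEopen E).mem_nhds hrE,
        hG.continuous.continuousAt (Icc_mem_nhds hm hn)] with u hu1 hu2 hu3 huA
      exact hu1 ⟨huA, f u, hu3, (hE E u hu2).1⟩

end

/-! ### Segments in the level sets of the region -/

/-- The segment between `(p, a)` and `(p, b)` lies in the closed region between the graphs. -/
def Linked (c₁ c₂ : ℝ → ℝ) (p a b : ℝ) : Prop := ∀ t ∈ uIcc a b, c₁ t ≤ p ∧ p ≤ c₂ t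

section Linked

variable {c₁ c₂ : ℝ → ℝ} {p a b c x y : ℝ}

lemma Linked.symm (h : Linked c₁ c₂ p a b) : Linked c₁ c₂ p b a := by
  rwa [Linked, uIcc_comm]

lemma Linked.trans (h : Linked c₁ c₂ p a b) (h' : Linked c₁ c₂ p b c) : Linked c₁ c₂ p a c :=
  fun t ht => (uIcc_subset_uIcc_union_uIcc ht).elim (h t) (h' t)

lemma Linked.left (h : Linked c₁ c₂ p a b) : c₁ a ≤ p ∧ p ≤ c₂ a := h a left_mem_uIcc

lemma Linked.right (h : Linked c₁ c₂ p a b) : c₁ b ≤ p ∧ p ≤ c₂ b := h b right_mem_uIcc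

lemma linked_self : Linked c₁ c₂ p a a ↔ c₁ a ≤ p ∧ p ≤ c₂ a := by simp [Linked]

/-- The reflection of the values exchanges the two graphs, and that of the line in `linked_comp_neg`
exchanges left and right. Local statements thus reduce to one side of the lower graph. -/
lemma linked_neg_values : Linked (fun x => -c₂ x) (fun x => -c₁ x) (-p) a b ↔ Linked c₁ c₂ p a b := by
  simp only [Linked, neg_le_neg_iff, and_comm]

lemma linked_comp_neg :
    Linked (fun x => c₁ (-x)) (fun x => c₂ (-x)) p (-a) (-b) ↔ Linked c₁ c₂ p a b := by
  have : ∀ {t}, t ∈ uIcc (-a) (-b) ↔ -t ∈ uIcc a b := by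
    intro t
    rw [mem_uIcc, mem_uIcc]
    constructor <;> rintro (h | h) <;> [right; left; right; left] <;> constructor <;> linarith [h.1, h.2]
  constructor
  · intro h t ht
    have := h (-t) (this.2 (by rwa [neg_neg]))
    simpa only [neg_neg] using this
  · intro h t ht
    exact h (-t) (this.1 ht)

lemma eventually_linked_of_strict (h₁ : Continuous c₁) (h₂ : Continuous c₂)
    (h : ∀ t ∈ uIcc a b, c₁ t < p ∧ p < c₂ t) : ∀ᶠ p' in 𝓝 p, Linked c₁ c₂ p' a b := by
  refine isCompact_uIcc.eventually_forall_of_forall_eventually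
    (P := fun p' t => c₁ t ≤ p' ∧ p' ≤ c₂ t) fun t ht => ?_
  have e1 : ∀ᶠ w : ℝ × ℝ in 𝓝 (p, t), c₁ w.2 < w.1 :=
    (isOpen_lt (by fun_prop) (by fun_prop)).mem_nhds (h t ht).1
  have e2 : ∀ᶠ w : ℝ × ℝ in 𝓝 (p, t), w.1 < c₂ w.2 :=
    (isOpen_lt (by fun_prop) (by fun_prop)).mem_nhds (h t ht).2
  filter_upwards [e1, e2] with w hw1 hw2 using ⟨hw1.le, hw2.le⟩

lemma exists_radius_lt (h₂ : Continuous c₂) (h : p < c₂ y) :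
    ∃ η > 0, ∃ r > p, ∀ t, |t - y| < η → r < c₂ t := by
  obtain ⟨r, hr1, hr2⟩ := exists_between h
  obtain ⟨η, hη, hb⟩ := Metric.eventually_nhds_iff.1
    ((isOpen_lt continuous_const h₂).mem_nhds (show r < c₂ y from hr2))
  exact ⟨η, hη, r, hr1, fun t ht => hb (by rwa [Real.dist_eq])⟩

lemma eventually_linked_of_strict_point (h₁ : Continuous c₁) (h₂ : Continuous c₂)
    (hy₁ : c₁ y < p) (hy₂ : p < c₂ y) : ∀ᶠ w : ℝ × ℝ in 𝓝 (p, y), Linked c₁ c₂ w.1 y w.2 := by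
  obtain ⟨η, hη, r, hr, hr'⟩ := exists_radius_lt h₂ hy₂
  obtain ⟨η', hη', r', hr₁, hr₁'⟩ := exists_radius_lt (c₂ := fun x => -c₁ x) (p := -p) (y := y)
    h₁.neg (neg_lt_neg hy₁)
  have e1 : ∀ᶠ w : ℝ × ℝ in 𝓝 (p, y), w.1 < r :=
    continuous_fst.continuousAt.eventually (Iio_mem_nhds hr)
  have e2 : ∀ᶠ w : ℝ × ℝ in 𝓝 (p, y), -r' < w.1 :=
    continuous_fst.continuousAt.eventually (Ioi_mem_nhds (show -r' < p by linarith))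
  have e3 : ∀ᶠ w : ℝ × ℝ in 𝓝 (p, y), w.2 ∈ Metric.ball y (min η η') :=
    continuous_snd.continuousAt.eventually (Metric.ball_mem_nhds _ (lt_min hη hη'))
  filter_upwards [e1, e2, e3] with w h1 h2 h3 t ht
  rw [Metric.mem_ball, Real.dist_eq] at h3
  have h4 : |t - y| ≤ |w.2 - y| := abs_sub_left_of_mem_uIcc ht
  have h5 := hr' t (h4.trans_lt (h3.trans_le (min_le_left _ _)))
  have h6 := hr₁' t (h4.trans_lt (h3.trans_le (min_le_right _ _)))
  constructor <;> linarith

/-- A differentiable function whose critical values near `y` agree with its value at `y` is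
monotone or antitone on a small interval to the right of `y`. -/
lemma exists_monotoneOn_or_antitoneOn_right {c : ℝ → ℝ} (hc : Differentiable ℝ c)
    (h : ∀ᶠ x in 𝓝 y, deriv c x = 0 → c x = c y) :
    ∃ ε > 0, MonotoneOn c (Icc y (y + ε)) ∨ AntitoneOn c (Icc y (y + ε)) := by
  obtain ⟨η, hη, hb⟩ := Metric.eventually_nhds_iff.1 h
  have hb' : ∀ x, y ≤ x → x < y + η → deriv c x = 0 → c x = c y := by
    intro x h1 h2
    refine hb ?_
    rw [Real.dist_eq, abs_lt]
    constructor <;> linarith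
  -- If the value `c y` recurs at some `x`, the extrema over `[y, x]` lie at the ends or at critical
  -- points, all with value `c y`, so `c` is constant there. Otherwise Rolle's theorem makes `c`
  -- injective to the right of `y`, hence strictly monotone.
  by_cases hcase : ∃ x, y < x ∧ x < y + η ∧ c x = c y
  · obtain ⟨x, hx1, hx2, hxc⟩ := hcase
    refine ⟨x - y, sub_pos.2 hx1, Or.inl ?_⟩
    rw [add_sub_cancel]
    have hne : (Icc y x).Nonempty := ⟨y, le_rfl, hx1.le⟩
    have hext : ∀ m ∈ Icc y x, IsExtrOn c (Icc y x) m → c m = c y := by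
      intro m hm hext
      rcases hm.1.eq_or_lt with rfl | h1
      · rfl
      rcases hm.2.eq_or_lt with rfl | h2
      · exact hxc
      exact hb' m h1.le (h2.trans hx2) (hext.isLocalExtr (Icc_mem_nhds h1 h2)).deriv_eq_zero
    obtain ⟨m, hm, hmin⟩ := isCompact_Icc.exists_isMinOn hne hc.continuous.continuousOn
    obtain ⟨M, hM, hmax⟩ := isCompact_Icc.exists_isMaxOn hne hc.continuous.continuousOn
    have e1 := hext m hm hmin.isExtr
    have e2 := hext M hM hmax.isExtr
    have hconst : ∀ t ∈ Icc y x, c t = c y := fun t ht =>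
      le_antisymm ((hmax ht).trans e2.le) (e1.symm.le.trans (hmin ht))
    intro s hs t ht _
    rw [hconst s hs, hconst t ht]
  · push Not at hcase
    refine ⟨η / 2, half_pos hη, ?_⟩
    have hinj : InjOn c (Icc y (y + η / 2)) := by
      have key : ∀ s ∈ Icc y (y + η / 2), ∀ t ∈ Icc y (y + η / 2), s < t → c s ≠ c t := by
        intro s hs t ht hst he
        obtain ⟨u, hu, hu0⟩ := exists_deriv_eq_zero hst hc.continuous.continuousOn he
        have h1 : y < u := hs.1.trans_lt hu.1
        have h2 : u < y + η := by linarith [hu.2, ht.2]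
        exact hcase u h1 h2 (hb' u h1.le h2 hu0)
      intro s hs t ht he
      rcases lt_trichotomy s t with h | h | h
      · exact absurd he (key s hs t ht h)
      · exact h
      · exact absurd he.symm (key t ht s hs h)
    rcases ContinuousOn.strictMonoOn_of_injOn_Icc' (by linarith) hc.continuous.continuousOn hinj
      with h | h
    · exact Or.inl h.monotoneOn
    · exact Or.inr h.antitoneOn

/-- Where `c₁` increases, points above the graph see the column of `y`. Where it decreases, points
on levels at least `p` still do, while those on lower levels are linked to the far end of the
monotone stretch. The upper graph stays out of reach as `p < c₂ y`. -/
lemma exists_linked_right (hc₁ : Differentiable ℝ c₁) (h₂ : Continuous c₂)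
    (h : ∀ᶠ x in 𝓝 y, deriv c₁ x = 0 → c₁ x = c₁ y) (hy : c₁ y = p) (hp : p < c₂ y) :
    ∃ x, Linked c₁ c₂ p y x ∧ ∀ᶠ w : ℝ × ℝ in 𝓝 (p, y), y ≤ w.2 → c₁ w.2 ≤ w.1 →
      Linked c₁ c₂ w.1 y w.2 ∨ Linked c₁ c₂ w.1 x w.2 := by
  obtain ⟨ε, hε, hmono⟩ := exists_monotoneOn_or_antitoneOn_right hc₁ h
  obtain ⟨η, hη, r, hr, hr'⟩ := exists_radius_lt h₂ hp
  have hr'' : ∀ t ∈ Icc y (y + min ε (η / 2)), r < c₂ t := by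
    intro t ht
    refine hr' t (abs_lt.2 ⟨by linarith [ht.1], ?_⟩)
    linarith [ht.2, min_le_right ε (η / 2)]
  have hsub : Icc y (y + min ε (η / 2)) ⊆ Icc y (y + ε) :=
    Icc_subset_Icc_right (by linarith [min_le_left ε (η / 2)])
  set ε' := min ε (η / 2) with hε'
  have hpos : 0 < ε' := lt_min hε (half_pos hη)
  have e1 : ∀ᶠ w : ℝ × ℝ in 𝓝 (p, y), w.1 < r :=
    continuous_fst.continuousAt.eventually (Iio_mem_nhds hr)
  have e2 : ∀ᶠ w : ℝ × ℝ in 𝓝 (p, y), w.2 < y + ε' :=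
    continuous_snd.continuousAt.eventually (Iio_mem_nhds (show y < y + ε' by linarith))
  rcases hmono with hm | hm
  · have hm := hm.mono hsub
    refine ⟨y, linked_self.2 ⟨hy.le, hp.le⟩, ?_⟩
    filter_upwards [e1, e2] with w h1 h2 h3 h4
    left
    intro t ht
    rw [uIcc_of_le h3] at ht
    have ht' : t ∈ Icc y (y + ε') := ⟨ht.1, ht.2.trans h2.le⟩
    exact ⟨(hm ht' ⟨h3, h2.le⟩ ht.2).trans h4, (h1.trans (hr'' t ht')).le⟩
  · have hm := hm.mono hsub
    have hyI : y ∈ Icc y (y + ε') := ⟨le_rfl, by linarith⟩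
    refine ⟨y + ε', ?_, ?_⟩
    · intro t ht
      rw [uIcc_of_le (by linarith)] at ht
      exact ⟨(hm hyI ht ht.1).trans hy.le, (hr.trans (hr'' t ht)).le⟩
    · filter_upwards [e1, e2] with w h1 h2 h3 h4
      rcases le_total p w.1 with hle | hle
      · left
        intro t ht
        rw [uIcc_of_le h3] at ht
        have ht' : t ∈ Icc y (y + ε') := ⟨ht.1, ht.2.trans h2.le⟩
        exact ⟨(hm hyI ht' ht.1).trans (hy.le.trans hle), (h1.trans (hr'' t ht')).le⟩
      · right
        intro t ht
        rw [uIcc_of_ge h2.le] at ht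
        have ht' : t ∈ Icc y (y + ε') := ⟨h3.trans ht.1, ht.2⟩
        exact ⟨(hm ⟨h3, h2.le⟩ ht' ht.1).trans h4, (h1.trans (hr'' t ht')).le⟩

lemma eventually_crit_comp_neg {c : ℝ → ℝ} (h : ∀ᶠ x in 𝓝 y, deriv c x = 0 → c x = c y) :
    ∀ᶠ x in 𝓝 (-y), deriv (fun x => c (-x)) x = 0 → c (-x) = c (-(-y)) := by
  have : Filter.Tendsto (fun x : ℝ => -x) (𝓝 (-y)) (𝓝 y) := by
    simpa using (continuous_neg (G := ℝ)).tendsto (-y)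
  filter_upwards [this.eventually h] with x hx h0
  rw [deriv_comp_neg, neg_eq_zero] at h0
  rw [neg_neg, hx h0]

/-- Points close to a point of the lower graph are linked to one of finitely many columns. -/
lemma exists_finite_linked_lower (hc₁ : Differentiable ℝ c₁) (h₂ : Continuous c₂)
    (h : ∀ᶠ x in 𝓝 y, deriv c₁ x = 0 → c₁ x = c₁ y) (hy : c₁ y = p) (hp : p < c₂ y) :
    ∃ F : Set ℝ, F.Finite ∧ (∀ x ∈ F, Linked c₁ c₂ p y x) ∧
      ∀ᶠ w : ℝ × ℝ in 𝓝 (p, y), c₁ w.2 ≤ w.1 → ∃ x ∈ F, Linked c₁ c₂ w.1 x w.2 := by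
  obtain ⟨x, hx, hxw⟩ := exists_linked_right hc₁ h₂ h hy hp
  obtain ⟨x', hx', hxw'⟩ := exists_linked_right (c₁ := fun x => c₁ (-x)) (c₂ := fun x => c₂ (-x))
    (y := -y) (p := p) (hc₁.comp differentiable_neg) (by fun_prop) (eventually_crit_comp_neg h)
    (by simpa using hy) (by simpa using hp)
  have htend : Filter.Tendsto (fun w : ℝ × ℝ => (w.1, -w.2)) (𝓝 (p, y)) (𝓝 (p, -y)) :=
    Continuous.tendsto (by fun_prop : Continuous fun w : ℝ × ℝ => (w.1, -w.2)) (p, y)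
  refine ⟨{y, x, -x'}, by simp, ?_, ?_⟩
  · rintro u (rfl | rfl | rfl)
    · exact linked_self.2 ⟨hy.le, hp.le⟩
    · exact hx
    · rw [← linked_comp_neg, neg_neg]; exact hx'
  · filter_upwards [hxw, htend.eventually hxw'] with w h1 h2 h3
    rcases le_total y w.2 with hle | hle
    · rcases h1 hle h3 with h | h
      · exact ⟨y, by simp, h⟩
      · exact ⟨x, by simp, h⟩
    · rcases h2 (by simpa using hle) (by simpa using h3) with h | h
      · exact ⟨y, by simp, linked_comp_neg.1 h⟩
      · refine ⟨-x', by simp, ?_⟩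
        rw [← linked_comp_neg, neg_neg]; exact h

/-- Points of the closed region close to a given one are linked to one of finitely many columns. -/
lemma exists_finite_linked (hc₁ : Differentiable ℝ c₁) (hc₂ : Differentiable ℝ c₂)
    (hlt : c₁ y < c₂ y) (h₁ : ∀ᶠ x in 𝓝 y, deriv c₁ x = 0 → c₁ x = c₁ y)
    (h₂ : ∀ᶠ x in 𝓝 y, deriv c₂ x = 0 → c₂ x = c₂ y) (hy₁ : c₁ y ≤ p) (hy₂ : p ≤ c₂ y) :
    ∃ F : Set ℝ, F.Finite ∧ (∀ x ∈ F, Linked c₁ c₂ p y x) ∧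
      ∀ᶠ w : ℝ × ℝ in 𝓝 (p, y), c₁ w.2 ≤ w.1 → w.1 ≤ c₂ w.2 →
        ∃ x ∈ F, Linked c₁ c₂ w.1 x w.2 := by
  rcases hy₁.eq_or_lt with e₁ | e₁
  · obtain ⟨F, hF, hF1, hF2⟩ := exists_finite_linked_lower hc₁ hc₂.continuous h₁ e₁ (e₁ ▸ hlt)
    exact ⟨F, hF, hF1, hF2.mono fun w h h' _ => h h'⟩
  rcases hy₂.eq_or_lt with e₂ | e₂
  · obtain ⟨F, hF, hF1, hF2⟩ := exists_finite_linked_lower (c₁ := fun x => -c₂ x)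
      (c₂ := fun x => -c₁ x) (y := y) (p := -p) hc₂.neg hc₁.continuous.neg
      (h₂.mono fun x hx h0 => by rw [deriv.fun_neg, neg_eq_zero] at h0; rw [hx h0])
      (by rw [e₂]) (neg_lt_neg e₁)
    refine ⟨F, hF, fun x hx => linked_neg_values.1 (hF1 x hx), ?_⟩
    have htend : Filter.Tendsto (fun w : ℝ × ℝ => (-w.1, w.2)) (𝓝 (p, y)) (𝓝 (-p, y)) :=
      Continuous.tendsto (by fun_prop : Continuous fun w : ℝ × ℝ => (-w.1, w.2)) (p, y)
    filter_upwards [htend.eventually hF2] with w h _ h'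
    obtain ⟨x, hx, hxl⟩ := h (neg_le_neg h')
    exact ⟨x, hx, linked_neg_values.1 hxl⟩
  · refine ⟨{y}, finite_singleton y, ?_, ?_⟩
    · rintro x rfl
      exact linked_self.2 ⟨hy₁, hy₂⟩
    · filter_upwards [eventually_linked_of_strict_point hc₁.continuous hc₂.continuous e₁ e₂]
        with w hw _ _ using ⟨y, rfl, hw⟩

/-- The column is `a = y - ε` with `c₁` strictly increasing around `y`: on the stretch from `a` to a
nearby point the graph is highest at that point, so the segment stays in the region. -/
lemma exists_strict_linked_of_deriv_pos (hc₁ : ContDiff ℝ 1 c₁) (h₂ : Continuous c₂)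
    (hy : c₁ y = p) (hp : p < c₂ y) (hd : 0 < deriv c₁ y) :
    ∃ a, c₁ a < p ∧ p < c₂ a ∧ Linked c₁ c₂ p a y ∧
      ∀ᶠ w : ℝ × ℝ in 𝓝 (p, y), c₁ w.2 ≤ w.1 → Linked c₁ c₂ w.1 a w.2 := by
  obtain ⟨η', hη', r', hr₁, hr₁'⟩ := exists_radius_lt (c₂ := deriv c₁) (p := 0) (y := y)
    (hc₁.continuous_deriv le_rfl) hd
  obtain ⟨η, hη, r, hr, hr'⟩ := exists_radius_lt h₂ hp
  obtain ⟨ε, hε, hlt⟩ := exists_between (lt_min hη hη')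
  have hball : ∀ t ∈ Icc (y - ε) (y + ε), |t - y| < min η η' := fun t ht =>
    (abs_le.2 ⟨by linarith [ht.1], by linarith [ht.2]⟩ : |t - y| ≤ ε).trans_lt hlt
  have hc₂' : ∀ t ∈ Icc (y - ε) (y + ε), r < c₂ t := fun t ht =>
    hr' t ((hball t ht).trans_le (min_le_left _ _))
  have hmono : StrictMonoOn c₁ (Icc (y - ε) (y + ε)) := by
    refine strictMonoOn_of_deriv_pos (convex_Icc _ _) hc₁.continuous.continuousOn fun t ht => ?_
    exact hr₁.trans (hr₁' t ((hball t (interior_subset ht)).trans_le (min_le_right _ _)))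
  have haI : y - ε ∈ Icc (y - ε) (y + ε) := ⟨le_rfl, by linarith⟩
  have hyI : y ∈ Icc (y - ε) (y + ε) := ⟨by linarith, by linarith⟩
  refine ⟨y - ε, hy ▸ hmono haI hyI (by linarith), hr.trans (hc₂' _ haI), ?_, ?_⟩
  · intro t ht
    rw [uIcc_of_le (by linarith)] at ht
    have htI : t ∈ Icc (y - ε) (y + ε) := ⟨ht.1, by linarith [ht.2]⟩
    exact ⟨(hmono.monotoneOn htI hyI ht.2).trans hy.le, (hr.trans (hc₂' t htI)).le⟩
  · have e1 : ∀ᶠ w : ℝ × ℝ in 𝓝 (p, y), w.1 < r :=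
      continuous_fst.continuousAt.eventually (Iio_mem_nhds hr)
    have e2 : ∀ᶠ w : ℝ × ℝ in 𝓝 (p, y), w.2 ∈ Icc (y - ε) (y + ε) :=
      continuous_snd.continuousAt.eventually (Icc_mem_nhds (show y - ε < y by linarith) (by simpa))
    filter_upwards [e1, e2] with w h1 h2 h3 t ht
    rw [uIcc_of_le h2.1] at ht
    have htI : t ∈ Icc (y - ε) (y + ε) := ⟨ht.1, ht.2.trans h2.2⟩
    exact ⟨(hmono.monotoneOn htI h2 ht.2).trans h3, (h1.trans (hc₂' t htI)).le⟩

lemma exists_strict_linked_lower (hc₁ : ContDiff ℝ 1 c₁) (h₂ : Continuous c₂)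
    (hy : c₁ y = p) (hp : p < c₂ y) (hd : deriv c₁ y ≠ 0) :
    ∃ a, c₁ a < p ∧ p < c₂ a ∧ Linked c₁ c₂ p a y ∧
      ∀ᶠ w : ℝ × ℝ in 𝓝 (p, y), c₁ w.2 ≤ w.1 → Linked c₁ c₂ w.1 a w.2 := by
  rcases hd.lt_or_gt with hd | hd
  · obtain ⟨a, ha1, ha2, ha3, ha4⟩ := exists_strict_linked_of_deriv_pos (c₁ := fun x => c₁ (-x))
      (c₂ := fun x => c₂ (-x)) (y := -y) (p := p) (hc₁.comp contDiff_neg) (by fun_prop)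
      (by simpa using hy) (by simpa using hp) (by rw [deriv_comp_neg, neg_neg]; linarith)
    refine ⟨-a, ha1, ha2, ?_, ?_⟩
    · rw [← linked_comp_neg, neg_neg]; exact ha3
    · have htend : Filter.Tendsto (fun w : ℝ × ℝ => (w.1, -w.2)) (𝓝 (p, y)) (𝓝 (p, -y)) :=
        Continuous.tendsto (by fun_prop : Continuous fun w : ℝ × ℝ => (w.1, -w.2)) (p, y)
      filter_upwards [htend.eventually ha4] with w h1 h2
      rw [← linked_comp_neg, neg_neg]
      exact h1 (by simpa using h2)
  · exact exists_strict_linked_of_deriv_pos hc₁ h₂ hy hp hd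

/-- Near a noncritical point of the closed region, every point is linked to one column through the
open region. -/
lemma exists_strict_linked (hc₁ : ContDiff ℝ 1 c₁) (hc₂ : ContDiff ℝ 1 c₂)
    (hlt : c₁ y < c₂ y) (hy₁ : c₁ y ≤ p) (hy₂ : p ≤ c₂ y) (h₁ : c₁ y = p → deriv c₁ y ≠ 0)
    (h₂ : c₂ y = p → deriv c₂ y ≠ 0) :
    ∃ a, c₁ a < p ∧ p < c₂ a ∧ Linked c₁ c₂ p a y ∧
      ∀ᶠ w : ℝ × ℝ in 𝓝 (p, y), c₁ w.2 ≤ w.1 → w.1 ≤ c₂ w.2 → Linked c₁ c₂ w.1 a w.2 := by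
  rcases hy₁.eq_or_lt with e₁ | e₁
  · obtain ⟨a, ha1, ha2, ha3, ha4⟩ :=
      exists_strict_linked_lower hc₁ hc₂.continuous e₁ (e₁ ▸ hlt) (h₁ e₁)
    exact ⟨a, ha1, ha2, ha3, ha4.mono fun w h h' _ => h h'⟩
  rcases hy₂.eq_or_lt with e₂ | e₂
  · obtain ⟨a, ha1, ha2, ha3, ha4⟩ := exists_strict_linked_lower (c₁ := fun x => -c₂ x)
      (c₂ := fun x => -c₁ x) (y := y) (p := -p) hc₂.neg hc₁.continuous.neg (by rw [e₂])
      (neg_lt_neg e₁) (by rw [deriv.fun_neg]; exact neg_ne_zero.2 (h₂ e₂.symm))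
    refine ⟨a, neg_lt_neg_iff.1 ha2, neg_lt_neg_iff.1 ha1, linked_neg_values.1 ha3, ?_⟩
    have htend : Filter.Tendsto (fun w : ℝ × ℝ => (-w.1, w.2)) (𝓝 (p, y)) (𝓝 (-p, y)) :=
      Continuous.tendsto (by fun_prop : Continuous fun w : ℝ × ℝ => (-w.1, w.2)) (p, y)
    filter_upwards [htend.eventually ha4] with w h _ h'
    exact linked_neg_values.1 (h (neg_le_neg h'))
  · refine ⟨y, e₁, e₂, linked_self.2 ⟨hy₁, hy₂⟩, ?_⟩
    filter_upwards [eventually_linked_of_strict_point hc₁.continuous hc₂.continuous e₁ e₂]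
      with w hw _ _ using hw

/-- On a level segment without critical points whose ends lie in the open region, all points do. -/
lemma Linked.strict (h : Linked c₁ c₂ p a b) (ha₁ : c₁ a < p) (ha₂ : p < c₂ a) (hb₁ : c₁ b < p)
    (hb₂ : p < c₂ b) (hcrit : ∀ t ∈ uIcc a b, (c₁ t = p → deriv c₁ t ≠ 0) ∧
      (c₂ t = p → deriv c₂ t ≠ 0)) : ∀ t ∈ uIcc a b, c₁ t < p ∧ p < c₂ t := by
  intro t ht
  -- The ends lie in the open region, so a point where a graph touches the segment is interior to
  -- it, and there the graph has a local extremum.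
  have hnhds : c₁ t = p ∨ c₂ t = p → uIcc a b ∈ 𝓝 t := by
    intro he
    refine Icc_mem_nhds (lt_of_le_of_ne ht.1 ?_) (lt_of_le_of_ne ht.2 ?_) <;> rintro rfl
    · rcases min_choice a b with e | e <;> rw [e] at he <;> rcases he with he | he <;> linarith
    · rcases max_choice a b with e | e <;> rw [e] at he <;> rcases he with he | he <;> linarith
  constructor
  · refine lt_of_le_of_ne (h t ht).1 fun he => (hcrit t ht).1 he ?_
    refine IsLocalMax.deriv_eq_zero ?_
    filter_upwards [hnhds (Or.inl he)] with s hs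
    rw [he]
    exact (h s hs).1
  · refine lt_of_le_of_ne (h t ht).2 fun he => (hcrit t ht).2 he.symm ?_
    refine IsLocalMin.deriv_eq_zero ?_
    filter_upwards [hnhds (Or.inr he.symm)] with s hs
    rw [← he]
    exact (h s hs).2

end Linked

/-! ### Reeb spaces -/

section ReebBasics

variable {Y : Type*} [TopologicalSpace Y] {f : Y → ℝ} {y y' : Y}

lemma mem_contour_self (f : Y → ℝ) (y : Y) : y ∈ contour f y :=
  mem_connectedComponentIn rfl

lemma eq_of_mem_contour (h : y' ∈ contour f y) : f y' = f y :=
  connectedComponentIn_subset (f ⁻¹' {f y}) y h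

/-- The quotient map from the domain of a function to its Reeb space. -/
def reebMk (f : Y → ℝ) (y : Y) : ReebSpace f := Quotient.mk (reebSetoid f) y

lemma reebMk_eq_iff : reebMk f y = reebMk f y' ↔ y' ∈ contour f y := by
  have : reebMk f y = reebMk f y' ↔ contour f y = contour f y' := Quotient.eq
  rw [this]
  constructor
  · intro h
    rw [h]
    exact mem_contour_self f y'
  · intro h
    have e := eq_of_mem_contour h
    have := connectedComponentIn_eq h
    rw [contour, this, contour, e]

lemma isQuotientMap_reebMk (f : Y → ℝ) : IsQuotientMap (reebMk f) := isQuotientMap_quot_mk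

lemma continuous_reebMk (f : Y → ℝ) : Continuous (reebMk f) := continuous_quotient_mk'

lemma surjective_reebMk (f : Y → ℝ) : Function.Surjective (reebMk f) := Quotient.mk_surjective

/-- The function induced on the Reeb space. -/
def reebMap (f : Y → ℝ) : ReebSpace f → ℝ :=
  Quotient.lift f fun _ _ h => (eq_of_mem_contour (reebMk_eq_iff.1 (Quotient.sound h))).symm

lemma continuous_reebMap (hf : Continuous f) : Continuous (reebMap f) :=
  hf.quotient_lift _

end ReebBasics

/-! ### The Reeb space of the closed region between two graphs -/

section Region

variable {c₁ c₂ : ℝ → ℝ}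

lemma mem_closure_region_iff (h₁ : Continuous c₁) (h₂ : Continuous c₂) (hlt : ∀ x, c₁ x < c₂ x)
    {z : ℝ × ℝ} : z ∈ closure (region c₁ c₂) ↔ c₁ z.2 ≤ z.1 ∧ z.1 ≤ c₂ z.2 := by
  constructor
  · intro h
    have hcl : IsClosed {z : ℝ × ℝ | c₁ z.2 ≤ z.1 ∧ z.1 ≤ c₂ z.2} :=
      by
        simp only [ofPred_and]
        exact (isClosed_le (by fun_prop) (by fun_prop)).inter
          (isClosed_le (by fun_prop) (by fun_prop))
    have hsub : region c₁ c₂ ⊆ {z : ℝ × ℝ | c₁ z.2 ≤ z.1 ∧ z.1 ≤ c₂ z.2} := by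
      rintro w ⟨h1, h2⟩
      exact ⟨h1.le, h2.le⟩
    exact closure_minimal hsub hcl h
  · intro h
    have h3 : z.1 ∈ closure (Ioo (c₁ z.2) (c₂ z.2)) := by
      rw [closure_Ioo (hlt _).ne]
      exact h
    have h4 := image_closure_subset_closure_image (f := fun t : ℝ => (t, z.2)) (by fun_prop)
      (mem_image_of_mem _ h3)
    refine closure_mono ?_ h4
    rintro _ ⟨t, ht, rfl⟩
    exact ht

lemma continuous_regionProj : Continuous (regionProj c₁ c₂) :=
  continuous_fst.comp continuous_subtype_val

lemma mem_contour_regionProj_iff (h₁ : Continuous c₁) (h₂ : Continuous c₂)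
    (hlt : ∀ x, c₁ x < c₂ x) {z z' : closure (region c₁ c₂)} :
    z' ∈ contour (regionProj c₁ c₂) z ↔
      z'.1.1 = z.1.1 ∧ Linked c₁ c₂ z.1.1 z.1.2 z'.1.2 := by
  constructor
  · intro h
    have he : z'.1.1 = z.1.1 := eq_of_mem_contour (f := regionProj c₁ c₂) h
    refine ⟨he, fun t ht => ?_⟩
    have hpre : IsPreconnected ((fun w : closure (region c₁ c₂) => w.1.2) ''
        contour (regionProj c₁ c₂) z) :=
      isPreconnected_connectedComponentIn.image _ (by fun_prop)
    obtain ⟨w, hw, rfl⟩ := hpre.ordConnected.uIcc_subset ⟨z, mem_contour_self _ z, rfl⟩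
      ⟨z', h, rfl⟩ ht
    have hw1 : w.1.1 = z.1.1 := eq_of_mem_contour (f := regionProj c₁ c₂) hw
    have := (mem_closure_region_iff h₁ h₂ hlt).1 w.2
    rwa [hw1] at this
  · rintro ⟨he, hl⟩
    let φ : uIcc z.1.2 z'.1.2 → closure (region c₁ c₂) := fun t =>
      ⟨(z.1.1, t), (mem_closure_region_iff h₁ h₂ hlt).2 (hl t t.2)⟩
    have hφ : Continuous φ := by
      refine Continuous.subtype_mk ?_ _
      fun_prop
    have : PreconnectedSpace (uIcc z.1.2 z'.1.2) :=
      isPreconnected_iff_preconnectedSpace.1 isPreconnected_uIcc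
    have hr : IsPreconnected (range φ) := isPreconnected_range hφ
    refine hr.subset_connectedComponentIn ⟨⟨z.1.2, left_mem_uIcc⟩, rfl⟩ ?_
      ⟨⟨z'.1.2, right_mem_uIcc⟩, ?_⟩
    · rintro _ ⟨t, rfl⟩
      rfl
    · exact Subtype.ext (Prod.ext he.symm rfl)

lemma reebMk_regionProj_eq_iff (h₁ : Continuous c₁) (h₂ : Continuous c₂)
    (hlt : ∀ x, c₁ x < c₂ x) {z z' : closure (region c₁ c₂)} :
    reebMk (regionProj c₁ c₂) z = reebMk (regionProj c₁ c₂) z' ↔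
      z'.1.1 = z.1.1 ∧ Linked c₁ c₂ z.1.1 z.1.2 z'.1.2 :=
  reebMk_eq_iff.trans (mem_contour_regionProj_iff h₁ h₂ hlt)

/-- Distinct levels are separated by the value. Distinct contours on one level are separated by some
`t` with `p` outside `[c₁ t, c₂ t]`: on the levels outside this interval no contour crosses the
column `t`, so the two sides of it are open, saturated and disjoint. -/
lemma t2Space_reebSpace_region (h₁ : Continuous c₁) (h₂ : Continuous c₂)
    (hlt : ∀ x, c₁ x < c₂ x) : T2Space (ReebSpace (regionProj c₁ c₂)) := by
  refine ⟨fun r r' hne => ?_⟩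
  obtain ⟨z, rfl⟩ := surjective_reebMk _ r
  obtain ⟨z', rfl⟩ := surjective_reebMk _ r'
  have hq := fun {z z'} => reebMk_regionProj_eq_iff h₁ h₂ hlt (z := z) (z' := z')
  by_cases he : z'.1.1 = z.1.1
  · rw [Ne, hq] at hne
    have hne : ¬ Linked c₁ c₂ z.1.1 z.1.2 z'.1.2 := fun h => hne ⟨he, h⟩
    simp only [Linked, not_forall] at hne
    obtain ⟨t, ht, htn⟩ := hne
    have hopen : IsOpen {w : closure (region c₁ c₂) | w.1.1 < c₁ t ∨ c₂ t < w.1.1} := by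
      simp only [ofPred_or]
      exact (isOpen_lt (by fun_prop) (by fun_prop)).union (isOpen_lt (by fun_prop) (by fun_prop))
    have htw : ∀ w : closure (region c₁ c₂), w.1.2 = t → ¬ (w.1.1 < c₁ t ∨ c₂ t < w.1.1) := by
      rintro w rfl
      have := (mem_closure_region_iff h₁ h₂ hlt).1 w.2
      rw [not_or, not_lt, not_lt]
      exact this
    have htz : z.1.1 < c₁ t ∨ c₂ t < z.1.1 := by
      by_contra hcon
      rw [not_or, not_lt, not_lt] at hcon
      exact htn hcon
    let A : Bool → Set (closure (region c₁ c₂)) := fun b =>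
      {w | w.1.1 < c₁ t ∨ c₂ t < w.1.1} ∩ {w | if b then w.1.2 < t else t < w.1.2}
    have hA : ∀ b, IsOpen (A b) := by
      intro b
      refine hopen.inter ?_
      cases b
      · simpa using isOpen_lt (f := fun _ => t)
          (g := fun w : closure (region c₁ c₂) => w.1.2) (by fun_prop) (by fun_prop)
      · simpa using isOpen_lt (g := fun _ => t)
          (f := fun w : closure (region c₁ c₂) => w.1.2) (by fun_prop) (by fun_prop)
    have hsat : ∀ b w w', w ∈ A b → reebMk (regionProj c₁ c₂) w = reebMk _ w' → w' ∈ A b := by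
      rintro b w w' ⟨hw1, hw2⟩ hww
      obtain ⟨e, hl⟩ := hq.1 hww
      refine ⟨by rwa [mem_ofPred_eq, e], ?_⟩
      have hnot : t ∉ uIcc w.1.2 w'.1.2 := by
        intro h
        have := hl t h
        rw [mem_ofPred_eq, ← not_le, ← not_le, ← not_and_or] at hw1
        exact hw1 this
      rw [mem_uIcc, not_or, not_and, not_and] at hnot
      cases b
      · have hw2 : t < w.1.2 := by simpa using hw2
        have : t < w'.1.2 := by
          by_contra h
          exact hnot.2 (not_lt.1 h) hw2.le
        simpa using this
      · have hw2 : w.1.2 < t := by simpa using hw2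
        have : w'.1.2 < t := by
          by_contra h
          exact hnot.1 hw2.le (not_lt.1 h)
        simpa using this
    have himg : ∀ b, IsOpen (reebMk (regionProj c₁ c₂) '' A b) := by
      intro b
      rw [← (isQuotientMap_reebMk _).isOpen_preimage]
      convert hA b using 1
      ext w
      constructor
      · rintro ⟨w', hw', e⟩
        exact hsat b w' w hw' e
      · exact fun h => ⟨w, h, rfl⟩
    have hdisj : Disjoint (reebMk (regionProj c₁ c₂) '' A true) (reebMk _ '' A false) := by
      rw [Set.disjoint_left]
      rintro _ ⟨w, hw, rfl⟩ ⟨w', hw', e⟩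
      have h1 := (hsat false w' w hw' e).2
      have h2 := hw.2
      simp only [mem_ofPred_eq, if_true, Bool.false_eq_true, if_false] at h1 h2
      exact lt_asymm h1 h2
    have hzt : z.1.2 ≠ t := fun h => htw z h htz
    have hzt' : z'.1.2 ≠ t := fun h => htw z' h (by rwa [he])
    have hz' : z' ∈ {w : closure (region c₁ c₂) | w.1.1 < c₁ t ∨ c₂ t < w.1.1} := by
      rwa [mem_ofPred_eq, he]
    rw [mem_uIcc] at ht
    rcases ht with ht | ht
    · refine ⟨_, _, himg true, himg false, ⟨z, ⟨htz, ?_⟩, rfl⟩, ⟨z', ⟨hz', ?_⟩, rfl⟩, hdisj⟩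
      · simpa using lt_of_le_of_ne ht.1 hzt
      · simpa using lt_of_le_of_ne ht.2 hzt'.symm
    · refine ⟨_, _, himg false, himg true, ⟨z, ⟨htz, ?_⟩, rfl⟩, ⟨z', ⟨hz', ?_⟩, rfl⟩, hdisj.symm⟩
      · simpa using lt_of_le_of_ne ht.2 hzt.symm
      · simpa using lt_of_le_of_ne ht.1 hzt'
  · have hc : Continuous (reebMap (regionProj c₁ c₂)) := continuous_reebMap continuous_regionProj
    obtain ⟨u, v, hu, hv, h1, h2, huv⟩ := t2_separation (Ne.symm he)
    exact ⟨_, _, hu.preimage hc, hv.preimage hc, h1, h2, huv.preimage _⟩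

/-- The contours that contain critical points, as points of the Reeb space. -/
def critContours (c₁ c₂ : ℝ → ℝ) : Set (ReebSpace (regionProj c₁ c₂)) :=
  reebMk (regionProj c₁ c₂) '' {z | (z : ℝ × ℝ) ∈ critPoints c₁ c₂}

/-- Critical contours do not accumulate from other levels. -/
def CritIsolated (c₁ c₂ : ℝ → ℝ) : Prop :=
  ∀ z : closure (region c₁ c₂), ∀ᶠ w in 𝓝 z,
    reebMk (regionProj c₁ c₂) w ∈ critContours c₁ c₂ → w.1.1 = z.1.1

lemma mem_critPoints_iff {z : ℝ × ℝ} : z ∈ critPoints c₁ c₂ ↔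
    (c₁ z.2 = z.1 ∧ deriv c₁ z.2 = 0) ∨ (c₂ z.2 = z.1 ∧ deriv c₂ z.2 = 0) := by
  rcases z with ⟨p, x⟩
  simp only [critPoints, critSet, mem_union, mem_image, mem_ofPred_eq, Prod.mk.injEq]
  constructor
  · rintro (⟨x, h, rfl, rfl⟩ | ⟨x, h, rfl, rfl⟩)
    · exact Or.inl ⟨rfl, h⟩
    · exact Or.inr ⟨rfl, h⟩
  · rintro (⟨h, h'⟩ | ⟨h, h'⟩)
    · exact Or.inl ⟨x, h', h, rfl⟩
    · exact Or.inr ⟨x, h', h, rfl⟩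

/-- The vertical line through the region in the column `x`, made constant outside the region. -/
noncomputable def column (h₁ : Continuous c₁) (h₂ : Continuous c₂) (hlt : ∀ x, c₁ x < c₂ x)
    (x t : ℝ) : closure (region c₁ c₂) :=
  ⟨(projIcc _ _ (hlt x).le t, x),
    (mem_closure_region_iff h₁ h₂ hlt).2 (projIcc _ _ (hlt x).le t).2⟩

variable (h₁ : Continuous c₁) (h₂ : Continuous c₂) (hlt : ∀ x, c₁ x < c₂ x)

lemma continuous_column (x : ℝ) : Continuous (column h₁ h₂ hlt x) := by
  refine Continuous.subtype_mk ?_ _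
  exact (continuous_subtype_val.comp continuous_projIcc).prodMk continuous_const

lemma column_coe {x t : ℝ} (h : c₁ x ≤ t ∧ t ≤ c₂ x) :
    (column h₁ h₂ hlt x t : ℝ × ℝ) = (t, x) := by
  simp only [column, projIcc_of_mem _ (show t ∈ Icc (c₁ x) (c₂ x) from h)]

lemma reebMk_column_eq_iff {x : ℝ} {z : closure (region c₁ c₂)}
    (h : c₁ x ≤ z.1.1 ∧ z.1.1 ≤ c₂ x) :
    reebMk (regionProj c₁ c₂) (column h₁ h₂ hlt x z.1.1) = reebMk _ z ↔
      Linked c₁ c₂ z.1.1 x z.1.2 := by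
  rw [reebMk_regionProj_eq_iff h₁ h₂ hlt, column_coe h₁ h₂ hlt h]
  simp

/-- Isolation of critical contours, read along the curve `x ↦ (c x, x)`, is the condition needed for
local monotonicity of the graphs. -/
lemma eventually_crit_of_critIsolated {c₁ c₂ : ℝ → ℝ} (h₁ : Continuous c₁) (h₂ : Continuous c₂)
    (hlt : ∀ x, c₁ x < c₂ x) (hI : CritIsolated c₁ c₂) (y : ℝ) :
    (∀ᶠ x in 𝓝 y, deriv c₁ x = 0 → c₁ x = c₁ y) ∧
      ∀ᶠ x in 𝓝 y, deriv c₂ x = 0 → c₂ x = c₂ y := by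
  have key : ∀ c : ℝ → ℝ, Continuous c → (∀ x, c₁ x ≤ c x ∧ c x ≤ c₂ x) →
      (∀ x, deriv c x = 0 → (c x, x) ∈ critPoints c₁ c₂) →
      ∀ᶠ x in 𝓝 y, deriv c x = 0 → c x = c y := by
    intro c hc hcc hcrit
    let φ : ℝ → closure (region c₁ c₂) := fun x =>
      ⟨(c x, x), (mem_closure_region_iff h₁ h₂ hlt).2 (hcc x)⟩
    have hφ : Continuous φ := Continuous.subtype_mk (by fun_prop) _
    filter_upwards [hφ.continuousAt.eventually (hI (φ y))] with x hx h0
    exact hx ⟨φ x, hcrit x h0, rfl⟩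
  exact ⟨key c₁ h₁ (fun x => ⟨le_rfl, (hlt x).le⟩) fun x h => mem_critPoints_iff.2 (Or.inl ⟨rfl, h⟩),
    key c₂ h₂ (fun x => ⟨(hlt x).le, le_rfl⟩) fun x h => mem_critPoints_iff.2 (Or.inr ⟨rfl, h⟩)⟩

end Region

/-! ### Graph structure on the Reeb space of the region -/

section RegionGraph

variable {c₁ c₂ : ℝ → ℝ}

lemma not_crit_of_notMem_critContours {z w : closure (region c₁ c₂)}
    (hz : reebMk (regionProj c₁ c₂) z ∉ critContours c₁ c₂)
    (h : reebMk (regionProj c₁ c₂) z = reebMk _ w) :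
    (c₁ w.1.2 = w.1.1 → deriv c₁ w.1.2 ≠ 0) ∧ (c₂ w.1.2 = w.1.1 → deriv c₂ w.1.2 ≠ 0) :=
  ⟨fun h1 h2 => hz (h ▸ ⟨w, mem_critPoints_iff.2 (Or.inl ⟨h1, h2⟩), rfl⟩),
    fun h1 h2 => hz (h ▸ ⟨w, mem_critPoints_iff.2 (Or.inr ⟨h1, h2⟩), rfl⟩)⟩

/-- Near a noncritical contour every point is linked to a given column that meets the contour in
the open region. -/
lemma eventually_linked_column (hc₁ : ContDiff ℝ 1 c₁) (hc₂ : ContDiff ℝ 1 c₂)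
    (hlt : ∀ x, c₁ x < c₂ x) {z : closure (region c₁ c₂)} {x : ℝ}
    (hz : reebMk (regionProj c₁ c₂) z ∉ critContours c₁ c₂)
    (hx₁ : c₁ x < z.1.1) (hx₂ : z.1.1 < c₂ x) (hl : Linked c₁ c₂ z.1.1 x z.1.2) :
    ∀ᶠ w in 𝓝 z, Linked c₁ c₂ w.1.1 x w.1.2 := by
  have h₁ := hc₁.continuous
  have h₂ := hc₂.continuous
  have hzr := (mem_closure_region_iff h₁ h₂ hlt).1 z.2
  have hz' := not_crit_of_notMem_critContours hz rfl
  obtain ⟨a, ha1, ha2, ha3, ha4⟩ := exists_strict_linked hc₁ hc₂ (hlt z.1.2) hzr.1 hzr.2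
    hz'.1 hz'.2
  have hxa := hl.trans ha3.symm
  -- The segment between the columns `x` and `a` is part of the noncritical contour of `z`, so it
  -- runs through the open region and persists on nearby levels.
  have hstrict := hxa.strict hx₁ hx₂ ha1 ha2 fun t ht => by
    let w : closure (region c₁ c₂) := ⟨(z.1.1, t), (mem_closure_region_iff h₁ h₂ hlt).2 (hxa t ht)⟩
    have hzw : Linked c₁ c₂ z.1.1 x t := fun u hu =>
      hxa u (uIcc_subset_uIcc_left ht hu)
    exact not_crit_of_notMem_critContours (w := w) hz
      ((reebMk_regionProj_eq_iff h₁ h₂ hlt).2 ⟨rfl, hl.symm.trans hzw⟩)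
  have e1 := eventually_linked_of_strict h₁ h₂ hstrict
  have e2 : ∀ᶠ w : closure (region c₁ c₂) in 𝓝 z, Linked c₁ c₂ w.1.1 x a :=
    continuous_regionProj.continuousAt.eventually e1
  filter_upwards [e2, continuous_subtype_val.continuousAt.eventually ha4] with w hw1 hw2
  have := (mem_closure_region_iff h₁ h₂ hlt).1 w.2
  exact hw1.trans (hw2 this.1 this.2)

/-- Columns supply everything: one that crosses a noncritical contour in the open region projects to
a chart, and the finitely many columns near a point of a critical contour project to branches, at
most one upwards and one downwards each. -/
theorem isGraphLike_reebSpace_region (hc₁ : ContDiff ℝ 1 c₁) (hc₂ : ContDiff ℝ 1 c₂)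
    (hlt : ∀ x, c₁ x < c₂ x) (hI : CritIsolated c₁ c₂) :
    IsGraphLike (reebMap (regionProj c₁ c₂)) (critContours c₁ c₂) := by
  have h₁ := hc₁.continuous
  have h₂ := hc₂.continuous
  have hq := fun {z z'} => reebMk_regionProj_eq_iff h₁ h₂ hlt (z := z) (z' := z')
  have hmem := fun {z} => mem_closure_region_iff h₁ h₂ hlt (z := z)
  have chart : ∀ w, w ∉ critContours c₁ c₂ → ∃ s : ℝ → ReebSpace (regionProj c₁ c₂), ∃ δ > 0,
      IsSectionOn (reebMap (regionProj c₁ c₂)) (critContours c₁ c₂) s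
        (Ioo (reebMap _ w - δ) (reebMap _ w + δ)) ∧ s (reebMap _ w) = w ∧
      IsOpen (s '' Ioo (reebMap _ w - δ) (reebMap _ w + δ)) := by
    intro r hr
    obtain ⟨z, rfl⟩ := surjective_reebMk _ r
    have hzr := hmem.1 z.2
    have hz' := not_crit_of_notMem_critContours hr rfl
    obtain ⟨a, ha1, ha2, ha3, -⟩ := exists_strict_linked hc₁ hc₂ (hlt z.1.2) hzr.1 hzr.2
      hz'.1 hz'.2
    let s : ℝ → ReebSpace (regionProj c₁ c₂) := fun t => reebMk _ (column h₁ h₂ hlt a t)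
    have hsc : Continuous s := (continuous_reebMk _).comp (continuous_column h₁ h₂ hlt a)
    have hsz : s z.1.1 = reebMk _ z :=
      (reebMk_column_eq_iff h₁ h₂ hlt ⟨ha1.le, ha2.le⟩).2 ha3
    have e1 : ∀ᶠ t in 𝓝 z.1.1, t ∈ Ioo (c₁ a) (c₂ a) := Ioo_mem_nhds ha1 ha2
    -- Isolation leaves only the level of `z` itself, where the column hits the contour of `z`,
    -- which is not critical.
    have e2 : ∀ᶠ t in 𝓝 z.1.1, s t ∉ critContours c₁ c₂ := by
      have := (continuous_column h₁ h₂ hlt a).continuousAt.eventually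
        (hI (column h₁ h₂ hlt a z.1.1))
      filter_upwards [this, e1] with t ht ht' htc
      have ht'' := ht htc
      rw [column_coe h₁ h₂ hlt ⟨ht'.1.le, ht'.2.le⟩, column_coe h₁ h₂ hlt ⟨ha1.le, ha2.le⟩] at ht''
      simp only at ht''
      subst ht''
      exact hr (hsz ▸ htc)
    obtain ⟨δ, hδ, hb⟩ := Metric.eventually_nhds_iff.1 (e1.and e2)
    have hb' : ∀ t ∈ Ioo (z.1.1 - δ) (z.1.1 + δ), t ∈ Ioo (c₁ a) (c₂ a) ∧
        s t ∉ critContours c₁ c₂ := by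
      intro t ht
      refine hb ?_
      rw [Real.dist_eq, abs_lt]
      constructor <;> linarith [ht.1, ht.2]
    have hinv : ∀ t ∈ Ioo (z.1.1 - δ) (z.1.1 + δ), reebMap (regionProj c₁ c₂) (s t) = t := by
      intro t ht
      have := (hb' t ht).1
      exact congrArg Prod.fst (column_coe h₁ h₂ hlt ⟨this.1.le, this.2.le⟩)
    refine ⟨s, δ, hδ, ⟨hsc.continuousOn, hinv, fun t ht => (hb' t ht).2⟩, hsz, ?_⟩
    rw [← (isQuotientMap_reebMk _).isOpen_preimage, isOpen_iff_mem_nhds]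
    rintro w ⟨t, ht, htw⟩
    have htI := (hb' t ht).1
    have htw1 : t = w.1.1 := by
      have := congrArg (reebMap (regionProj c₁ c₂)) htw
      rw [hinv t ht] at this
      exact this
    subst htw1
    have hlw := (reebMk_column_eq_iff h₁ h₂ hlt ⟨htI.1.le, htI.2.le⟩).1 htw
    have e3 := eventually_linked_column hc₁ hc₂ hlt (z := w) (htw ▸ (hb' _ ht).2) htI.1 htI.2 hlw
    have e4 : ∀ᶠ u : closure (region c₁ c₂) in 𝓝 w, u.1.1 ∈ Ioo (z.1.1 - δ) (z.1.1 + δ) :=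
      continuous_regionProj.continuousAt.eventually (isOpen_Ioo.mem_nhds ht)
    filter_upwards [e3, e4] with u hu1 hu2
    exact ⟨u.1.1, hu2, (reebMk_column_eq_iff h₁ h₂ hlt hu1.left).2 hu1⟩
  have hc := continuous_reebMap (continuous_regionProj (c₁ := c₁) (c₂ := c₂))
  refine HasCharts.isGraphLike_of_isQuotientMap ⟨hc, chart⟩ (isQuotientMap_reebMk _) ?_
  intro z _ U hzU hbr
  have hzr := hmem.1 z.2
  obtain ⟨hcr₁, hcr₂⟩ := eventually_crit_of_critIsolated h₁ h₂ hlt hI z.1.2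
  obtain ⟨F, hF, hFz, hFw⟩ := exists_finite_linked (hc₁.differentiable one_ne_zero)
    (hc₂.differentiable one_ne_zero) (hlt z.1.2) hcr₁ hcr₂ hzr.1 hzr.2
  have hcol : ∀ x ∈ F, ∀ᶠ t in 𝓝 z.1.1, c₁ x ≤ t ∧ t ≤ c₂ x →
      reebMk (regionProj c₁ c₂) (column h₁ h₂ hlt x t) ∈ U := by
    intro x hx
    have hxz := (hFz x hx).right
    have hs : reebMk (regionProj c₁ c₂) (column h₁ h₂ hlt x z.1.1) = reebMk _ z :=
      (reebMk_column_eq_iff h₁ h₂ hlt hxz).2 (hFz x hx).symm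
    have hsc : Continuous fun t => reebMk (regionProj c₁ c₂) (column h₁ h₂ hlt x t) :=
      (continuous_reebMk _).comp (continuous_column h₁ h₂ hlt x)
    have e1 := (continuous_column h₁ h₂ hlt x).continuousAt.eventually
      (hI (column h₁ h₂ hlt x z.1.1))
    rw [column_coe h₁ h₂ hlt hxz] at e1
    obtain ⟨δ, hδ, hb⟩ := Metric.eventually_nhds_iff.1 e1
    have key : ∀ a b, a < b → (z.1.1 = a ∨ z.1.1 = b) → c₁ x ≤ a → b ≤ c₂ x →
        (∀ t ∈ Ioo a b, |t - z.1.1| < δ) → ∀ᶠ t in 𝓝[Ioo a b] z.1.1,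
        reebMk (regionProj c₁ c₂) (column h₁ h₂ hlt x t) ∈ U := by
      intro a b hab hend ha hb' hδ'
      refine hbr a b _ ⟨hab, hend, ⟨hsc.continuousOn, fun t ht => ?_, fun t ht htc => ?_⟩, ?_⟩
      · exact congrArg Prod.fst
          (column_coe h₁ h₂ hlt ⟨ha.trans ht.1.le, ht.2.le.trans hb'⟩)
      · have h3 := hb (by rw [Real.dist_eq]; exact hδ' t ht) htc
        rw [column_coe h₁ h₂ hlt ⟨ha.trans ht.1.le, ht.2.le.trans hb'⟩] at h3
        rcases hend with e | e
        · exact ht.1.ne' (h3.trans e)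
        · exact ht.2.ne (h3.trans e)
      · have h5 := (hsc.tendsto z.1.1).mono_left (nhdsWithin_le_nhds (s := Ioo a b))
        rw [hs] at h5
        exact h5
    have hup : ∀ᶠ t in 𝓝[>] z.1.1, c₁ x ≤ t ∧ t ≤ c₂ x →
        reebMk (regionProj c₁ c₂) (column h₁ h₂ hlt x t) ∈ U := by
      rcases hxz.2.lt_or_eq with hlt' | heq
      · have hpos : z.1.1 < min (c₂ x) (z.1.1 + δ) := lt_min hlt' (by linarith)
        have := key z.1.1 _ hpos (Or.inl rfl) hxz.1 (min_le_left _ _) fun t ht =>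
          abs_lt.2 ⟨by linarith [ht.1], by linarith [ht.2, min_le_right (c₂ x) (z.1.1 + δ)]⟩
        rw [nhdsWithin_Ioo_eq_nhdsGT hpos] at this
        exact this.mono fun t ht _ => ht
      -- The column ends at the level of `z`, so it has no points above it.
      · filter_upwards [self_mem_nhdsWithin] with t ht ht'
        exact absurd (ht'.2.trans heq.symm.le) (not_le.2 ht)
    have hdown : ∀ᶠ t in 𝓝[<] z.1.1, c₁ x ≤ t ∧ t ≤ c₂ x →
        reebMk (regionProj c₁ c₂) (column h₁ h₂ hlt x t) ∈ U := by
      rcases hxz.1.lt_or_eq with hlt' | heq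
      · have hpos : max (c₁ x) (z.1.1 - δ) < z.1.1 := max_lt hlt' (by linarith)
        have := key _ z.1.1 hpos (Or.inr rfl) (le_max_left _ _) hxz.2 fun t ht =>
          abs_lt.2 ⟨by linarith [ht.1, le_max_right (c₁ x) (z.1.1 - δ)], by linarith [ht.2]⟩
        rw [nhdsWithin_Ioo_eq_nhdsLT hpos] at this
        exact this.mono fun t ht _ => ht
      · filter_upwards [self_mem_nhdsWithin] with t ht ht'
        exact absurd (heq.symm.le.trans ht'.1) (not_le.2 ht)
    filter_upwards [eventually_nhdsWithin_iff.1 hup, eventually_nhdsWithin_iff.1 hdown]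
      with t h1 h2 h3
    rcases lt_trichotomy t z.1.1 with h | h | h
    · exact h2 h h3
    · rw [h, hs]; exact hzU
    · exact h1 h h3
  have hall : ∀ᶠ w : closure (region c₁ c₂) in 𝓝 z, ∀ x ∈ F, c₁ x ≤ w.1.1 ∧ w.1.1 ≤ c₂ x →
      reebMk (regionProj c₁ c₂) (column h₁ h₂ hlt x w.1.1) ∈ U :=
    continuous_regionProj.continuousAt.eventually ((Filter.eventually_all_finite hF).2 hcol)
  filter_upwards [hall, continuous_subtype_val.continuousAt.eventually hFw] with w hw1 hw2
  have hwr := hmem.1 w.2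
  obtain ⟨x, hx, hl⟩ := hw2 hwr.1 hwr.2
  have := hw1 x hx hl.left
  rwa [(reebMk_column_eq_iff h₁ h₂ hlt hl.left).2 hl] at this

end RegionGraph

/-! ### Isolation of critical contours from the conditions on `Z` -/

section Hypotheses

variable {c₁ c₂ : ℝ → ℝ}

lemma value_mem_critValues {z : ℝ × ℝ} (h : z ∈ critPoints c₁ c₂) : z.1 ∈ critValues c₁ c₂ := by
  rcases h with ⟨x, hx, rfl⟩ | ⟨x, hx, rfl⟩
  · exact Or.inl ⟨x, hx, rfl⟩
  · exact Or.inr ⟨x, hx, rfl⟩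

/-- On levels outside `Z` the critical values themselves do not accumulate. On levels in `Z`, a
critical contour through a point of the good neighbourhood stays inside it by saturation, so its
critical points lie on the central contour. -/
lemma critIsolated_of_goodNhds {Z : Set ℝ} (hZclosed : IsClosed Z)
    (hVclosed : IsClosed ((↑) ⁻¹' critValues c₁ c₂ : Set (Zᶜ : Set ℝ)))
    (hVdiscrete : IsDiscrete (critValues c₁ c₂ \ Z))
    (hK : ∀ z : closure (region c₁ c₂), regionProj c₁ c₂ z ∈ Z → ∃ K, IsGoodNhd c₁ c₂ z K) :
    CritIsolated c₁ c₂ := by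
  intro z
  by_cases hz : z.1.1 ∈ Z
  · obtain ⟨K, hK⟩ := hK z hz
    filter_upwards [mem_nhdsSet_iff_forall.1 hK.nhd z (mem_contour_self _ z)] with w hw
    rintro ⟨u, hu, huw⟩
    have huc : u ∈ contour (regionProj c₁ c₂) w := reebMk_eq_iff.1 huw.symm
    have h1 : u.1.1 = w.1.1 := eq_of_mem_contour (f := regionProj c₁ c₂) huc
    by_contra hne
    refine hK.noCrit u ⟨hK.saturated w hw huc, fun h => hne ?_⟩ hu
    exact h1.symm.trans (eq_of_mem_contour (f := regionProj c₁ c₂) h)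
  · have hZ : Zᶜ ∈ 𝓝 z.1.1 := hZclosed.isOpen_compl.mem_nhds hz
    have key : ∀ᶠ t in 𝓝 z.1.1, t ∈ critValues c₁ c₂ → t = z.1.1 := by
      by_cases hp : z.1.1 ∈ critValues c₁ c₂
      · have := isDiscrete_iff_nhdsWithin.1 hVdiscrete z.1.1 ⟨hp, hz⟩
        have h2 : ∀ᶠ t in 𝓝[critValues c₁ c₂ \ Z] z.1.1, t = z.1.1 := by
          rw [this]
          exact rfl
        filter_upwards [eventually_nhdsWithin_iff.1 h2, hZ] with t h3 h4 h5
        exact h3 ⟨h5, h4⟩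
      · have h1 : ((↑) ⁻¹' critValues c₁ c₂ : Set (Zᶜ : Set ℝ))ᶜ ∈ 𝓝 (⟨z.1.1, hz⟩ : (Zᶜ : Set ℝ)) :=
          hVclosed.isOpen_compl.mem_nhds hp
        have h2 := (hZclosed.isOpen_compl.isOpenEmbedding_subtypeVal.image_mem_nhds).2 h1
        filter_upwards [h2] with t ht htc
        obtain ⟨u, hu, rfl⟩ := ht
        exact absurd htc hu
    filter_upwards [continuous_regionProj.continuousAt.eventually key] with w hw
    rintro ⟨u, hu, huw⟩
    have h1 : u.1.1 = w.1.1 :=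
      eq_of_mem_contour (f := regionProj c₁ c₂) (reebMk_eq_iff.1 huw.symm)
    have := value_mem_critValues hu
    rw [h1] at this
    exact hw this

/-- Guarantees a one-dimensional cell: along a column, levels close to but different from a given
one are noncritical. -/
lemma exists_notMem_critContours (h₁ : Continuous c₁) (h₂ : Continuous c₂)
    (hlt : ∀ x, c₁ x < c₂ x) (hI : CritIsolated c₁ c₂) : ∃ w, w ∉ critContours c₁ c₂ := by
  obtain ⟨p, hp1, hp2⟩ := exists_between (hlt 0)
  have e1 := (continuous_column h₁ h₂ hlt 0).continuousAt.eventually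
    (hI (column h₁ h₂ hlt 0 p))
  have e2 := nhdsWithin_le_nhds (s := {p}ᶜ) (e1.and (Ioo_mem_nhds hp1 hp2))
  obtain ⟨t, ⟨ht1, ht2⟩, ht3⟩ := (Filter.Eventually.and e2 self_mem_nhdsWithin).exists
  refine ⟨reebMk _ (column h₁ h₂ hlt 0 t), fun h => ht3 ?_⟩
  have := ht1 h
  rwa [column_coe h₁ h₂ hlt ⟨ht2.1.le, ht2.2.le⟩, column_coe h₁ h₂ hlt ⟨hp1.le, hp2.le⟩] at this

end Hypotheses

/-! ### Doubling an open part of a graph-like space -/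

section Doubling

lemma sections_eq {R R₀ : Type} {σ : Bool → R₀ → R} {w : R₀} (h : w ∉ {w | σ true w ≠ σ false w}) (b b' : Bool) :
    σ b w = σ b' w := by
  have h : σ true w = σ false w := not_not.1 h
  cases b <;> cases b' <;> simp [h]

variable {R R₀ : Type} [TopologicalSpace R] [TopologicalSpace R₀] {f₀ : R₀ → ℝ} {V₀ : Set R₀}
  {π : R → R₀} {σ : Bool → R₀ → R}

lemma isOpen_ne_of_isOpen_image (hσ : ∀ b, Continuous (σ b)) (hπσ : ∀ b w, π (σ b w) = w)
    (hO : ∀ b, IsOpen (σ b '' {w | σ true w ≠ σ false w})) :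
    IsOpen {w | σ true w ≠ σ false w} := by
  have : Function.Injective (σ true) := Function.LeftInverse.injective (hπσ true)
  rw [← preimage_image_eq {w | σ true w ≠ σ false w} this]
  exact (hO true).preimage (hσ true)

/-- Points over different base points are separated below; two points over the same base point lie
in the two sheets, which are open and disjoint. -/
lemma t2Space_of_doubling [T2Space R₀] (hπ : Continuous π)
    (hπσ : ∀ b w, π (σ b w) = w) (hsurj : ∀ r, ∃ b, σ b (π r) = r)
    (hO : ∀ b, IsOpen (σ b '' {w | σ true w ≠ σ false w})) : T2Space R := by
  refine ⟨fun r r' hne => ?_⟩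
  by_cases he : π r = π r'
  · obtain ⟨b, hb⟩ := hsurj r
    obtain ⟨b', hb'⟩ := hsurj r'
    have hw : π r ∈ {w | σ true w ≠ σ false w} := by
      by_contra hw
      exact hne (by rw [← hb, ← hb', ← he]; exact sections_eq hw b b')
    refine ⟨_, _, hO b, hO b', ⟨_, hw, hb⟩, ⟨_, he ▸ hw, hb'⟩, ?_⟩
    have hbb : b ≠ b' := by
      rintro rfl
      exact hne (by rw [← hb, ← hb', he])
    rw [Set.disjoint_left]
    rintro _ ⟨u, hu, rfl⟩ ⟨u', hu', huu⟩
    have e : u' = u := by rw [← hπσ b' u', huu, hπσ]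
    subst e
    apply hu
    cases b <;> cases b' <;> simp_all
  · obtain ⟨u, v, hu, hv, h1, h2, huv⟩ := t2_separation he
    exact ⟨_, _, hu.preimage hπ, hv.preimage hπ, h1, h2, huv.preimage _⟩

lemma IsSectionOn.comp_doubling {s : ℝ → R₀} {I : Set ℝ} (h : IsSectionOn f₀ V₀ s I) (b : Bool)
    (hσ : ∀ b, Continuous (σ b)) (hπσ : ∀ b w, π (σ b w) = w) :
    IsSectionOn (f₀ ∘ π) (π ⁻¹' V₀) (σ b ∘ s) I := by
  refine ⟨(hσ b).comp_continuousOn h.continuousOn, fun t ht => ?_, fun t ht => ?_⟩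
  · simp [hπσ, h.right_inv t ht]
  · simpa [hπσ] using h.notMem t ht

/-- A space covered by two sections over a graph-like space which differ exactly over an open
set, whose frontier consists of vertices, is graph-like. -/
theorem IsGraphLike.of_doubling (hG : IsGraphLike f₀ V₀) (hπ : Continuous π)
    (hσ : ∀ b, Continuous (σ b)) (hπσ : ∀ b w, π (σ b w) = w) (hsurj : ∀ r, ∃ b, σ b (π r) = r)
    (hO : ∀ b, IsOpen (σ b '' {w | σ true w ≠ σ false w}))
    (hOV : ∀ w ∈ V₀, σ true w = σ false w)
    (hOcl : ∀ w, w ∉ V₀ → σ true w = σ false w → ∀ᶠ w' in 𝓝 w, σ true w' = σ false w') :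
    IsGraphLike (f₀ ∘ π) (π ⁻¹' V₀) := by
  set O := {w | σ true w ≠ σ false w} with hOdef
  have hOopen : IsOpen O := isOpen_ne_of_isOpen_image hσ hπσ hO
  refine ⟨⟨hG.continuous.comp hπ, ?_⟩, ?_⟩
  · intro r hr
    obtain ⟨b, hb⟩ := hsurj r
    obtain ⟨s, δ, hδ, hs, hsr, -⟩ := hG.chart (π r) hr
    have hcont : ContinuousAt s (f₀ (π r)) :=
      hs.continuousOn.continuousAt (Ioo_mem_nhds (by linarith) (by linarith))
    -- A point off `V₀` is not on the frontier of `O`, so around it the space is either two disjoint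
    -- sheets or a single one.
    obtain ⟨N, hN, hNO⟩ : ∃ N ∈ 𝓝 (π r), N ⊆ O ∨ Disjoint N O := by
      by_cases hrO : π r ∈ O
      · exact ⟨O, hOopen.mem_nhds hrO, Or.inl Subset.rfl⟩
      · refine ⟨_, hOcl _ hr (not_not.1 hrO), Or.inr ?_⟩
        rw [Set.disjoint_left]
        exact fun w hw hwO => hwO hw
    have hsN : ∀ᶠ t in 𝓝 (f₀ (π r)), s t ∈ N := hcont.eventually (by rwa [hsr])
    obtain ⟨ε, hε, hεN⟩ := Metric.eventually_nhds_iff.1 hsN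
    have hsub : Ioo (f₀ (π r) - min δ ε) (f₀ (π r) + min δ ε) ⊆
        Ioo (f₀ (π r) - δ) (f₀ (π r) + δ) := by
      apply Ioo_subset_Ioo <;> linarith [min_le_left δ ε]
    have hs' := hs.mono hsub
    refine ⟨σ b ∘ s, min δ ε, lt_min hδ hε, hs'.comp_doubling b hσ hπσ, ?_, ?_⟩
    · simp only [Function.comp_apply, hsr, hb]
    · change IsOpen (σ b ∘ s '' Ioo (f₀ (π r) - min δ ε) (f₀ (π r) + min δ ε))
      have hU := hG.isOpen_image hs' isOpen_Ioo
      have hUN : s '' Ioo (f₀ (π r) - min δ ε) (f₀ (π r) + min δ ε) ⊆ N := by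
        rintro _ ⟨t, ht, rfl⟩
        refine hεN ?_
        rw [Real.dist_eq, abs_lt]
        constructor <;> linarith [ht.1, ht.2, min_le_right δ ε]
      rw [image_comp]
      set U := s '' Ioo (f₀ (π r) - min δ ε) (f₀ (π r) + min δ ε)
      rcases hNO with hNO | hNO
      · convert (hO b).inter (hU.preimage hπ) using 1
        ext u
        constructor
        · rintro ⟨w, hw, rfl⟩
          exact ⟨⟨w, hNO (hUN hw), rfl⟩, by rwa [mem_preimage, hπσ]⟩
        · rintro ⟨⟨w, hw, rfl⟩, hwU⟩
          rw [mem_preimage, hπσ] at hwU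
          exact ⟨w, hwU, rfl⟩
      · convert hU.preimage hπ using 1
        ext u
        constructor
        · rintro ⟨w, hw, rfl⟩
          rwa [mem_preimage, hπσ]
        · intro hu
          obtain ⟨b', hb'⟩ := hsurj u
          refine ⟨π u, hu, ?_⟩
          rw [sections_eq (Set.disjoint_left.1 hNO (hUN hu)) b b', hb']
  · intro v hv U hvU hbr
    -- Both sheets meet at a vertex, so branches downstairs lift to branches at `v` in each sheet,
    -- and the two neighbourhoods downstairs can be intersected.
    have hvO : π v ∉ O := not_not.2 (hOV _ hv)
    have hσv : ∀ b, σ b (π v) = v := by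
      intro b
      obtain ⟨b', hb'⟩ := hsurj v
      rw [sections_eq hvO b b', hb']
    have hnhds : ∀ b, σ b ⁻¹' U ∈ 𝓝 (π v) := by
      intro b
      refine hG.nhds_of_branches _ hv _ (by rwa [mem_preimage, hσv]) fun a c s hs => ?_
      refine hbr a c (σ b ∘ s) ⟨hs.lt, hs.endpoint, hs.isSectionOn.comp_doubling b hσ hπσ, ?_⟩
      have := ((hσ b).tendsto (π v)).comp hs.tendsto
      rwa [hσv] at this
    filter_upwards [hπ.continuousAt (hnhds true), hπ.continuousAt (hnhds false)] with r h1 h2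
    obtain ⟨b, hb⟩ := hsurj r
    rw [← hb]
    cases b
    · exact h2
    · exact h1

end Doubling

/-! ### Maps between Reeb spaces -/

section ReebLift

variable {Y Y' : Type*} [TopologicalSpace Y] [TopologicalSpace Y'] {f : Y → ℝ} {f' : Y' → ℝ}
  {φ : Y → Y'}

lemma reebMk_congr_of_continuous (hφ : Continuous φ) (hf : ∀ y, f' (φ y) = f y) {y y' : Y}
    (h : reebMk f y = reebMk f y') : reebMk f' (φ y) = reebMk f' (φ y') := by
  rw [reebMk_eq_iff] at h ⊢
  have hpre : IsPreconnected (φ '' contour f y) :=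
    isPreconnected_connectedComponentIn.image _ hφ.continuousOn
  refine hpre.subset_connectedComponentIn ⟨y, mem_contour_self f y, rfl⟩ ?_ ⟨y', h, rfl⟩
  rintro _ ⟨w, hw, rfl⟩
  change f' (φ w) = f' (φ y)
  rw [hf, hf, eq_of_mem_contour hw]

/-- The map between Reeb spaces induced by a continuous map compatible with the functions. -/
def reebLift (f : Y → ℝ) (f' : Y' → ℝ) (φ : Y → Y') (hφ : Continuous φ)
    (hf : ∀ y, f' (φ y) = f y) : ReebSpace f → ReebSpace f' :=
  Quotient.lift (fun y => reebMk f' (φ y)) fun _ _ h =>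
    reebMk_congr_of_continuous hφ hf (Quotient.sound h)

lemma continuous_reebLift (hφ : Continuous φ) (hf : ∀ y, f' (φ y) = f y) :
    Continuous (reebLift f f' φ hφ hf) :=
  ((continuous_reebMk f').comp hφ).quotient_lift _

end ReebLift

/-! ### The hypersurface over the region -/

section Hypersurface

variable {m : ℕ} {c₁ c₂ : ℝ → ℝ}

/-- The projection of the hypersurface to the closed region. -/
def toRegion (z : hypersurface m c₁ c₂) : closure (region c₁ c₂) := ⟨z.1.1, z.2.1⟩

lemma continuous_toRegion : Continuous (toRegion (m := m) (c₁ := c₁) (c₂ := c₂)) :=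
  Continuous.subtype_mk (by fun_prop) _

/-- The radius of the sphere in the hypersurface over a point of the region. -/
noncomputable def fibreRadius (c₁ c₂ : ℝ → ℝ) (z : ℝ × ℝ) : ℝ :=
  √((z.1 - c₁ z.2) * (c₂ z.2 - z.1))

lemma continuous_fibreRadius (h₁ : Continuous c₁) (h₂ : Continuous c₂) :
    Continuous (fibreRadius c₁ c₂) := by
  unfold fibreRadius
  fun_prop

lemma mem_hypersurface_iff (h₁ : Continuous c₁) (h₂ : Continuous c₂) (hlt : ∀ x, c₁ x < c₂ x)
    {z : (ℝ × ℝ) × EuclideanSpace ℝ (Fin (m - 1))} :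
    z ∈ hypersurface m c₁ c₂ ↔ z.1 ∈ closure (region c₁ c₂) ∧ ‖z.2‖ = fibreRadius c₁ c₂ z.1 := by
  have hsum : ∑ j, z.2 j ^ 2 = ‖z.2‖ ^ 2 := by
    rw [EuclideanSpace.norm_sq_eq]
    simp
  constructor
  · rintro ⟨hz, he⟩
    refine ⟨hz, ?_⟩
    rw [hsum, sub_eq_zero] at he
    rw [fibreRadius, he, Real.sqrt_sq (norm_nonneg _)]
  · rintro ⟨hz, he⟩
    refine ⟨hz, ?_⟩
    have := (mem_closure_region_iff h₁ h₂ hlt).1 hz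
    rw [hsum, he, fibreRadius, Real.sq_sqrt
      (mul_nonneg (by linarith [this.1]) (by linarith [this.2])), sub_self]

lemma fibreRadius_nonneg (z : ℝ × ℝ) : 0 ≤ fibreRadius c₁ c₂ z := Real.sqrt_nonneg _

/-- The lift of the region to the hypersurface in the direction of a unit vector. -/
noncomputable def liftAlong (h₁ : Continuous c₁) (h₂ : Continuous c₂) (hlt : ∀ x, c₁ x < c₂ x)
    (u : EuclideanSpace ℝ (Fin (m - 1))) (hu : ‖u‖ = 1) (z : closure (region c₁ c₂)) :
    hypersurface m c₁ c₂ :=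
  ⟨(z, fibreRadius c₁ c₂ z • u), (mem_hypersurface_iff h₁ h₂ hlt).2
    ⟨z.2, by rw [norm_smul, hu, mul_one, Real.norm_of_nonneg (fibreRadius_nonneg _)]⟩⟩

lemma continuous_liftAlong (h₁ : Continuous c₁) (h₂ : Continuous c₂) (hlt : ∀ x, c₁ x < c₂ x)
    (u : EuclideanSpace ℝ (Fin (m - 1))) (hu : ‖u‖ = 1) :
    Continuous (liftAlong h₁ h₂ hlt u hu) := by
  refine Continuous.subtype_mk ?_ _
  have := continuous_fibreRadius h₁ h₂
  fun_prop

/-- The contours in a hypersurface of dimension at least three contain the spheres over points. -/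
lemma reebMk_eq_of_toRegion_eq (h₁ : Continuous c₁) (h₂ : Continuous c₂)
    (hlt : ∀ x, c₁ x < c₂ x) (hm : 3 ≤ m) {y y' : hypersurface m c₁ c₂}
    (h : toRegion y = toRegion y') :
    reebMk (hypersurfaceProj m c₁ c₂) y = reebMk (hypersurfaceProj m c₁ c₂) y' := by
  have hrank : 1 < Module.rank ℝ (EuclideanSpace ℝ (Fin (m - 1))) := by
    rw [← Module.finrank_eq_rank, finrank_euclideanSpace_fin]
    exact_mod_cast (by omega : 1 < m - 1)
  have hsph := isPreconnected_sphere hrank (0 : EuclideanSpace ℝ (Fin (m - 1)))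
    (fibreRadius c₁ c₂ y.1.1)
  have : PreconnectedSpace
      (Metric.sphere (0 : EuclideanSpace ℝ (Fin (m - 1))) (fibreRadius c₁ c₂ y.1.1)) :=
    isPreconnected_iff_preconnectedSpace.1 hsph
  let φ : Metric.sphere (0 : EuclideanSpace ℝ (Fin (m - 1))) (fibreRadius c₁ c₂ y.1.1) →
      hypersurface m c₁ c₂ := fun u =>
    ⟨(y.1.1, u), (mem_hypersurface_iff h₁ h₂ hlt).2 ⟨y.2.1, mem_sphere_zero_iff_norm.1 u.2⟩⟩
  have hφ : Continuous φ := Continuous.subtype_mk (by fun_prop) _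
  have hy : ‖y.1.2‖ = fibreRadius c₁ c₂ y.1.1 := ((mem_hypersurface_iff h₁ h₂ hlt).1 y.2).2
  have hyy : y.1.1 = y'.1.1 := congrArg Subtype.val h
  have hy' : ‖y'.1.2‖ = fibreRadius c₁ c₂ y.1.1 := by
    rw [hyy]
    exact ((mem_hypersurface_iff h₁ h₂ hlt).1 y'.2).2
  rw [reebMk_eq_iff]
  refine (isPreconnected_range hφ).subset_connectedComponentIn
    ⟨⟨y.1.2, mem_sphere_zero_iff_norm.2 hy⟩, rfl⟩ ?_
    ⟨⟨y'.1.2, mem_sphere_zero_iff_norm.2 hy'⟩, ?_⟩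
  · rintro _ ⟨u, rfl⟩
    rfl
  · exact Subtype.ext (Prod.ext hyy rfl)

/-- On a level that does not lie strictly between the graphs, each contour reaches a graph. -/
lemma exists_linked_boundary (h₁ : Continuous c₁) (h₂ : Continuous c₂) {p y : ℝ} (hy : c₁ y ≤ p ∧ p ≤ c₂ y)
    (hp : ¬ ∀ x, c₁ x < p ∧ p < c₂ x) : ∃ x, Linked c₁ c₂ p y x ∧ (c₁ x = p ∨ c₂ x = p) := by
  obtain ⟨x₀, hx₀⟩ := not_forall.1 hp
  -- Nonnegative exactly over the points of the level inside the closed region, and zero there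
  -- exactly on the graphs. The zero nearest to `y` on the way to `x₀` is the required boundary
  -- point.
  set h : ℝ → ℝ := fun t => min (p - c₁ t) (c₂ t - p) with hdef
  have hh : Continuous h := by fun_prop
  have hy0 : 0 ≤ h y := le_min (by linarith [hy.1]) (by linarith [hy.2])
  have hx0 : h x₀ ≤ 0 := by
    by_contra hcon
    obtain ⟨h3, h4⟩ := lt_min_iff.1 (not_le.1 hcon)
    exact hx₀ ⟨by linarith, by linarith⟩
  have ivt : ∀ s, h s ≤ 0 → ∃ t ∈ uIcc y s, h t = 0 := by
    intro s hs
    have := intermediate_value_uIcc (a := y) (b := s) hh.continuousOn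
    exact this (mem_uIcc.2 (Or.inr ⟨hs, hy0⟩))
  have hcomp : IsCompact (uIcc y x₀ ∩ h ⁻¹' {0}) :=
    isCompact_uIcc.inter_right (isClosed_singleton.preimage hh)
  obtain ⟨t₀, ht₀, ht₀'⟩ := ivt x₀ hx0
  obtain ⟨x, ⟨hx1, hx2⟩, hmin⟩ := hcomp.exists_isMinOn ⟨t₀, ht₀, ht₀'⟩
    (f := fun t => |t - y|) (by fun_prop)
  have hx2 : h x = 0 := hx2
  have hnonneg : ∀ s ∈ uIcc y x, 0 ≤ h s := by
    intro s hs
    by_contra hneg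
    obtain ⟨t, ht, ht0⟩ := ivt s (not_le.1 hneg).le
    have h3 : |x - y| ≤ |t - y| :=
      hmin ⟨uIcc_subset_uIcc_left (uIcc_subset_uIcc_left hx1 hs) ht, ht0⟩
    have hts : t ≠ s := by
      rintro rfl
      exact hneg ht0.ge
    rw [mem_uIcc] at hs ht
    rcases hs with hs | hs <;> rcases ht with ht | ht
    · have h4 : t < s := lt_of_le_of_ne ht.2 hts
      rw [abs_of_nonneg (by linarith), abs_of_nonneg (by linarith)] at h3
      linarith
    · exact hts (by linarith)
    · exact hts (by linarith)
    · have h4 : s < t := lt_of_le_of_ne ht.1 hts.symm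
      rw [abs_of_nonpos (by linarith), abs_of_nonpos (by linarith)] at h3
      linarith
  refine ⟨x, fun s hs => ?_, ?_⟩
  · obtain ⟨h3, h4⟩ := le_min_iff.1 (hnonneg s hs)
    exact ⟨by linarith, by linarith⟩
  · rcases min_choice (p - c₁ x) (c₂ x - p) with e | e
    · left
      have : p - c₁ x = 0 := e ▸ hx2
      linarith
    · right
      have : c₂ x - p = 0 := e ▸ hx2
      linarith

end Hypersurface

/-! ### The two sheets of the Reeb space of the hypersurface -/

section HypersurfaceGraph

variable {m : ℕ} {c₁ c₂ : ℝ → ℝ}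

/-- The sign `1` or `-1` attached to a boolean. -/
def boolSign (b : Bool) : ℝ := if b then 1 else -1

lemma abs_boolSign (b : Bool) : |boolSign b| = 1 := by cases b <;> simp [boolSign]

/-- The two unit vectors on the first coordinate axis. -/
noncomputable def axisVector (hm : 2 ≤ m) (b : Bool) : EuclideanSpace ℝ (Fin (m - 1)) :=
  EuclideanSpace.single ⟨0, by omega⟩ (boolSign b)

lemma norm_axisVector (hm : 2 ≤ m) (b : Bool) : ‖axisVector hm b‖ = 1 := by
  rw [axisVector, PiLp.norm_single, Real.norm_eq_abs, abs_boolSign]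

/-- The first fibre coordinate of a point of the hypersurface. -/
def fibreCoord (hm : 2 ≤ m) (y : hypersurface m c₁ c₂) : ℝ := y.1.2 ⟨0, by omega⟩

lemma continuous_fibreCoord (hm : 2 ≤ m) :
    Continuous (fibreCoord (c₁ := c₁) (c₂ := c₂) hm) := by
  unfold fibreCoord
  fun_prop

/-- The two lifts of the region along the first coordinate axis. -/
noncomputable def axisLift (hm : 2 ≤ m) (h₁ : Continuous c₁) (h₂ : Continuous c₂)
    (hlt : ∀ x, c₁ x < c₂ x) (b : Bool) : closure (region c₁ c₂) → hypersurface m c₁ c₂ :=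
  liftAlong h₁ h₂ hlt (axisVector hm b) (norm_axisVector hm b)

variable (hm : 2 ≤ m) (h₁ : Continuous c₁) (h₂ : Continuous c₂) (hlt : ∀ x, c₁ x < c₂ x)

lemma fibreCoord_axisLift (b : Bool) (z : closure (region c₁ c₂)) :
    fibreCoord hm (axisLift hm h₁ h₂ hlt b z) = fibreRadius c₁ c₂ z * boolSign b := by
  simp [fibreCoord, axisLift, liftAlong, axisVector]

lemma axisLift_eq_of_fibreRadius_eq_zero {z : closure (region c₁ c₂)}
    (h : fibreRadius c₁ c₂ z = 0) (b b' : Bool) :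
    axisLift hm h₁ h₂ hlt b z = axisLift hm h₁ h₂ hlt b' z := by
  apply Subtype.ext
  simp [axisLift, liftAlong, h]

lemma abs_fibreCoord {c₁ c₂ : ℝ → ℝ} (h₁ : Continuous c₁) (h₂ : Continuous c₂)
    (hlt : ∀ x, c₁ x < c₂ x) (hm2 : m = 2) (y : hypersurface m c₁ c₂) :
    |fibreCoord hm y| = fibreRadius c₁ c₂ y.1.1 := by
  rw [← ((mem_hypersurface_iff h₁ h₂ hlt).1 y.2).2, EuclideanSpace.norm_eq,
    Finset.sum_eq_single ⟨0, by omega⟩, Real.norm_eq_abs, Real.sqrt_sq_eq_abs, abs_abs]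
  · rfl
  · intro i _ hi
    exact absurd (Fin.ext (by have := i.2; simp only; omega)) hi
  · simp

/-- With a single fibre coordinate, a point is determined by its projection and a sign; at
coordinate zero either sign works. -/
lemma axisLift_toRegion (hm2 : m = 2) {y : hypersurface m c₁ c₂} {b : Bool}
    (h : 0 ≤ boolSign b * fibreCoord hm y) :
    axisLift hm h₁ h₂ hlt b (toRegion y) = y := by
  have habs := abs_fibreCoord hm h₁ h₂ hlt hm2 y
  have hcoord : fibreRadius c₁ c₂ y.1.1 * boolSign b = fibreCoord hm y := by
    rw [← habs]
    cases b
    · simp only [boolSign, Bool.false_eq_true, if_false] at h ⊢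
      rw [abs_of_nonpos (by linarith)]
      ring
    · simp only [boolSign, if_true] at h ⊢
      rw [abs_of_nonneg (by linarith)]
      ring
  apply Subtype.ext
  refine Prod.ext rfl ?_
  ext i
  have hi : i = ⟨0, by omega⟩ := Fin.ext (by have := i.2; simp only; omega)
  subst hi
  exact (fibreCoord_axisLift hm h₁ h₂ hlt b (toRegion y)).trans hcoord

lemma exists_boolSign_mul_nonneg (t : ℝ) : ∃ b, 0 ≤ boolSign b * t := by
  rcases le_total 0 t with h | h
  · exact ⟨true, by simpa [boolSign] using h⟩
  · exact ⟨false, by simpa [boolSign] using h⟩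

lemma fibreRadius_pos {p x : ℝ} (h : c₁ x < p ∧ p < c₂ x) : 0 < fibreRadius c₁ c₂ (p, x) :=
  Real.sqrt_pos.2 (mul_pos (by simpa using h.1) (by simpa using h.2))

/-- Over a level lying strictly between the graphs, the sign of the fibre coordinate of a surface
is constant on contours. -/
lemma fibreCoord_pos_of_reebMk_eq {c₁ c₂ : ℝ → ℝ} (h₁ : Continuous c₁) (h₂ : Continuous c₂)
    (hlt : ∀ x, c₁ x < c₂ x) (hm2 : m = 2) {y y' : hypersurface m c₁ c₂}
    (hy : ∀ x, c₁ x < hypersurfaceProj m c₁ c₂ y ∧ hypersurfaceProj m c₁ c₂ y < c₂ x)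
    (h : reebMk (hypersurfaceProj m c₁ c₂) y = reebMk (hypersurfaceProj m c₁ c₂) y') {b : Bool}
    (hb : 0 < boolSign b * fibreCoord hm y) : 0 < boolSign b * fibreCoord hm y' := by
  have hpre : IsPreconnected ((fun w => boolSign b * fibreCoord hm w) ''
      contour (hypersurfaceProj m c₁ c₂) y) :=
    isPreconnected_connectedComponentIn.image _
      (continuous_const.mul (continuous_fibreCoord hm)).continuousOn
  by_contra hneg
  obtain ⟨w, hw, hw0⟩ := hpre.ordConnected.uIcc_subset
    ⟨y, mem_contour_self _ y, rfl⟩ ⟨y', reebMk_eq_iff.1 h, rfl⟩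
    (mem_uIcc.2 (Or.inr ⟨not_lt.1 hneg, hb.le⟩))
  have h3 : hypersurfaceProj m c₁ c₂ w = hypersurfaceProj m c₁ c₂ y := eq_of_mem_contour hw
  have h4 : |fibreCoord hm w| = 0 := by
    have := congrArg abs hw0
    simpa only [abs_mul, abs_boolSign, one_mul, abs_zero] using this
  rw [abs_fibreCoord hm h₁ h₂ hlt hm2 w] at h4
  have h5 := fibreRadius_pos (hy w.1.1.2)
  rw [← h3] at h5
  exact h5.ne' h4

/-- The section of the Reeb space of the hypersurface over that of the region. -/
noncomputable def reebSection (b : Bool) :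
    ReebSpace (regionProj c₁ c₂) → ReebSpace (hypersurfaceProj m c₁ c₂) :=
  reebLift _ _ (axisLift hm h₁ h₂ hlt b) (continuous_liftAlong h₁ h₂ hlt _ _) fun _ => rfl

/-- The contour can be followed to a graph, where the fibre is one point and the two lifts meet. -/
lemma reebSection_eq_of_level {z : closure (region c₁ c₂)}
    (hz : ¬ ∀ x, c₁ x < z.1.1 ∧ z.1.1 < c₂ x) (b b' : Bool) :
    reebSection hm h₁ h₂ hlt b (reebMk _ z) = reebSection hm h₁ h₂ hlt b' (reebMk _ z) := by
  obtain ⟨x, hx, hb⟩ := exists_linked_boundary h₁ h₂ ((mem_closure_region_iff h₁ h₂ hlt).1 z.2) hz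
  let w : closure (region c₁ c₂) :=
    ⟨(z.1.1, x), (mem_closure_region_iff h₁ h₂ hlt).2 hx.right⟩
  have hzw : reebMk (regionProj c₁ c₂) z = reebMk _ w :=
    (reebMk_regionProj_eq_iff h₁ h₂ hlt).2 ⟨rfl, hx⟩
  have hr : fibreRadius c₁ c₂ w = 0 := by
    rcases hb with h | h <;> simp [w, fibreRadius, h]
  rw [hzw]
  exact congrArg _ (axisLift_eq_of_fibreRadius_eq_zero hm h₁ h₂ hlt hr b b')

lemma reebSection_ne_of_level (hm2 : m = 2) {z : closure (region c₁ c₂)}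
    (hz : ∀ x, c₁ x < z.1.1 ∧ z.1.1 < c₂ x) :
    reebSection hm h₁ h₂ hlt true (reebMk _ z) ≠ reebSection hm h₁ h₂ hlt false (reebMk _ z) := by
  intro h
  have hr : 0 < fibreRadius c₁ c₂ z := fibreRadius_pos (hz z.1.2)
  have h3 := fibreCoord_pos_of_reebMk_eq hm h₁ h₂ hlt hm2 (b := true)
    (y := axisLift hm h₁ h₂ hlt true z) (y' := axisLift hm h₁ h₂ hlt false z) hz h
    (by rw [fibreCoord_axisLift]; simpa [boolSign] using hr)
  rw [fibreCoord_axisLift] at h3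
  simp only [boolSign, if_true, Bool.false_eq_true, if_false] at h3
  linarith

/-- The preimage of a sheet in the surface is cut out by two open conditions: the level lies
strictly between the graphs, and the fibre coordinate has the given sign. -/
lemma isOpen_image_reebSection (hm2 : m = 2)
    (hP : IsOpen {p : ℝ | ∀ x, c₁ x < p ∧ p < c₂ x}) (b : Bool) :
    IsOpen (reebSection hm h₁ h₂ hlt b ''
      {w | reebSection hm h₁ h₂ hlt true w ≠ reebSection hm h₁ h₂ hlt false w}) := by
  rw [← (isQuotientMap_reebMk _).isOpen_preimage]
  have hproj : Continuous (hypersurfaceProj m c₁ c₂) :=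
    (continuous_fst.comp continuous_fst).comp continuous_subtype_val
  have hpos : IsOpen {y : hypersurface m c₁ c₂ | 0 < boolSign b * fibreCoord hm y} :=
    isOpen_lt continuous_const (continuous_const.mul (continuous_fibreCoord hm))
  convert (hP.preimage hproj).inter hpos using 1
  ext y
  constructor
  · rintro ⟨w, hw, hwy⟩
    obtain ⟨z, rfl⟩ := surjective_reebMk _ w
    have hz : ∀ x, c₁ x < z.1.1 ∧ z.1.1 < c₂ x := by
      by_contra hz
      exact hw (reebSection_eq_of_level hm h₁ h₂ hlt hz _ _)
    have hwy : reebMk (hypersurfaceProj m c₁ c₂) (axisLift hm h₁ h₂ hlt b z) = reebMk _ y := hwy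
    have hlev : hypersurfaceProj m c₁ c₂ y = z.1.1 := eq_of_mem_contour (reebMk_eq_iff.1 hwy)
    refine ⟨?_, ?_⟩
    · intro x
      rw [hlev]
      exact hz x
    · refine fibreCoord_pos_of_reebMk_eq hm h₁ h₂ hlt hm2
        (y := axisLift hm h₁ h₂ hlt b z) hz hwy ?_
      rw [fibreCoord_axisLift, mul_comm, mul_assoc]
      have hr : 0 < fibreRadius c₁ c₂ z := fibreRadius_pos (hz z.1.2)
      cases b <;> simpa [boolSign] using hr
  · rintro ⟨hy1, hy2⟩
    refine ⟨reebMk _ (toRegion y), reebSection_ne_of_level hm h₁ h₂ hlt hm2 hy1, ?_⟩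
    exact congrArg (reebMk _) (axisLift_toRegion hm h₁ h₂ hlt hm2 (le_of_lt hy2))

/-- A noncritical contour on a level that does not lie strictly between the graphs is away from
the levels which do. -/
lemma notMem_closure_of_notMem_critContours {c₁ c₂ : ℝ → ℝ} (h₁ : Continuous c₁)
    (h₂ : Continuous c₂) (hlt : ∀ x, c₁ x < c₂ x) {z : closure (region c₁ c₂)}
    (hz : reebMk (regionProj c₁ c₂) z ∉ critContours c₁ c₂)
    (hzP : ¬ ∀ x, c₁ x < z.1.1 ∧ z.1.1 < c₂ x) :
    z.1.1 ∉ closure {p : ℝ | ∀ x, c₁ x < p ∧ p < c₂ x} := by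
  intro hcl
  -- At a limit of such levels the whole line lies in the closed region, so a graph touching it has
  -- a global extremum there, contradicting noncriticality.
  have hle : ∀ x, c₁ x ≤ z.1.1 ∧ z.1.1 ≤ c₂ x := fun x =>
    closure_minimal (t := Icc (c₁ x) (c₂ x)) (fun p hp => ⟨(hp x).1.le, (hp x).2.le⟩)
      isClosed_Icc hcl
  obtain ⟨x, hx, hb⟩ := exists_linked_boundary h₁ h₂ (hle z.1.2) hzP
  have hcrit := not_crit_of_notMem_critContours hz
    ((reebMk_regionProj_eq_iff h₁ h₂ hlt
      (z' := ⟨(z.1.1, x), (mem_closure_region_iff h₁ h₂ hlt).2 hx.right⟩)).2 ⟨rfl, hx⟩)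
  rcases hb with hb | hb
  · refine hcrit.1 hb (IsLocalMax.deriv_eq_zero ?_)
    exact Filter.Eventually.of_forall fun t => (hle t).1.trans hb.ge
  · refine hcrit.2 hb (IsLocalMin.deriv_eq_zero ?_)
    exact Filter.Eventually.of_forall fun t => hb.le.trans (hle t).2

lemma critContours_level {z : closure (region c₁ c₂)}
    (hz : reebMk (regionProj c₁ c₂) z ∈ critContours c₁ c₂) :
    ¬ ∀ x, c₁ x < z.1.1 ∧ z.1.1 < c₂ x := by
  obtain ⟨u, hu, huz⟩ := hz
  intro h
  have hlev : z.1.1 = u.1.1 := eq_of_mem_contour (f := regionProj c₁ c₂) (reebMk_eq_iff.1 huz)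
  have := h u.1.2
  rw [hlev] at this
  rcases mem_critPoints_iff.1 hu with ⟨h3, -⟩ | ⟨h3, -⟩
  · exact this.1.ne h3
  · exact this.2.ne' h3

/-- The Reeb space of the hypersurface is covered by two sections over that of the region. They
coincide for `m ≥ 3`; for `m = 2` they differ exactly over the levels strictly between the graphs.
-/
theorem isOneDimCW_reebSpace_hypersurface {m : ℕ} (hm : 2 ≤ m) {c₁ c₂ : ℝ → ℝ}
    (hc₁ : ContDiff ℝ 1 c₁) (hc₂ : ContDiff ℝ 1 c₂) (hlt : ∀ x, c₁ x < c₂ x)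
    (hP : m = 2 → IsOpen {p : ℝ | ∀ x, c₁ x < p ∧ p < c₂ x}) (hI : CritIsolated c₁ c₂) :
    IsOneDimCW (ReebSpace (hypersurfaceProj m c₁ c₂)) := by
  have h₁ := hc₁.continuous
  have h₂ := hc₂.continuous
  have := t2Space_reebSpace_region h₁ h₂ hlt
  have hG := isGraphLike_reebSpace_region hc₁ hc₂ hlt hI
  let π : ReebSpace (hypersurfaceProj m c₁ c₂) → ReebSpace (regionProj c₁ c₂) :=
    reebLift _ _ toRegion continuous_toRegion fun _ => rfl
  let σ : Bool → ReebSpace (regionProj c₁ c₂) → ReebSpace (hypersurfaceProj m c₁ c₂) :=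
    reebSection hm h₁ h₂ hlt
  have hπ : Continuous π := continuous_reebLift _ _
  have hσ : ∀ b, Continuous (σ b) := fun b => continuous_reebLift _ _
  have hπσ : ∀ b w, π (σ b w) = w := by
    intro b w
    obtain ⟨z, rfl⟩ := surjective_reebMk _ w
    rfl
  have h3 : 3 ≤ m → ∀ w, σ true w = σ false w := by
    intro hm3 w
    obtain ⟨z, rfl⟩ := surjective_reebMk _ w
    exact reebMk_eq_of_toRegion_eq h₁ h₂ hlt hm3 rfl
  have hsurj : ∀ r, ∃ b, σ b (π r) = r := by
    intro r
    obtain ⟨y, rfl⟩ := surjective_reebMk _ r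
    rcases hm.eq_or_lt with hm2 | hm3
    · obtain ⟨b, hb⟩ := exists_boolSign_mul_nonneg (fibreCoord hm y)
      exact ⟨b, congrArg (reebMk _) (axisLift_toRegion hm h₁ h₂ hlt hm2.symm hb)⟩
    · exact ⟨true, reebMk_eq_of_toRegion_eq h₁ h₂ hlt hm3 rfl⟩
  have hO : ∀ b, IsOpen (σ b '' {w | σ true w ≠ σ false w}) := by
    intro b
    rcases hm.eq_or_lt with hm2 | hm3
    · exact isOpen_image_reebSection hm h₁ h₂ hlt hm2.symm (hP hm2.symm) b
    · have : {w | σ true w ≠ σ false w} = ∅ := by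
        rw [eq_empty_iff_forall_notMem]
        exact fun w hw => hw (h3 hm3 w)
      rw [this, image_empty]
      exact isOpen_empty
  have hOV : ∀ w ∈ critContours c₁ c₂, σ true w = σ false w := by
    intro w hw
    obtain ⟨z, rfl⟩ := surjective_reebMk _ w
    exact reebSection_eq_of_level hm h₁ h₂ hlt (critContours_level hw) _ _
  have hOcl : ∀ w, w ∉ critContours c₁ c₂ → σ true w = σ false w →
      ∀ᶠ w' in 𝓝 w, σ true w' = σ false w' := by
    intro w hw he
    rcases hm.eq_or_lt with hm2 | hm3
    · obtain ⟨z, rfl⟩ := surjective_reebMk _ w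
      have hzP : ¬ ∀ x, c₁ x < z.1.1 ∧ z.1.1 < c₂ x := fun hz =>
        reebSection_ne_of_level hm h₁ h₂ hlt hm2.symm hz he
      have hncl := notMem_closure_of_notMem_critContours h₁ h₂ hlt hw hzP
      have hev : ∀ᶠ w' in 𝓝 (reebMk (regionProj c₁ c₂) z), reebMap (regionProj c₁ c₂) w' ∈
          (closure {p : ℝ | ∀ x, c₁ x < p ∧ p < c₂ x})ᶜ :=
        (continuous_reebMap continuous_regionProj).continuousAt.eventually
          (isClosed_closure.isOpen_compl.mem_nhds hncl)
      filter_upwards [hev] with w' hw'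
      obtain ⟨z', rfl⟩ := surjective_reebMk _ w'
      exact reebSection_eq_of_level hm h₁ h₂ hlt (fun hz' => hw' (subset_closure hz')) _ _
    · exact Filter.Eventually.of_forall (h3 hm3)
  have : T2Space (ReebSpace (hypersurfaceProj m c₁ c₂)) := t2Space_of_doubling hπ hπσ hsurj hO
  obtain ⟨w, hw⟩ := exists_notMem_critContours h₁ h₂ hlt hI
  refine (hG.of_doubling hπ hσ hπσ hsurj hO hOV hOcl).isOneDimCW ⟨σ true w, ?_⟩
  rwa [mem_preimage, hπσ]

end HypersurfaceGraph

/-! ### The theorem for graphs of functions with tame singularities -/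

theorem theorem1 (m : ℕ) (hm : 2 ≤ m) (c₁ c₂ : ℝ → ℝ) (h₁ : IsTS c₁) (h₂ : IsTS c₂)
    (hlt : ∀ x, c₁ x < c₂ x)
    (hm2 : m = 2 → IsOpen {p : ℝ | ∀ x, c₁ x < p ∧ p < c₂ x})
    (Z : Set ℝ) (hZclosed : IsClosed Z) (hZdiscrete : IsDiscrete Z)
    (hVclosed : IsClosed ((↑) ⁻¹' critValues c₁ c₂ : Set (Zᶜ : Set ℝ)))
    (hVdiscrete : IsDiscrete (critValues c₁ c₂ \ Z))
    (hK : ∀ z : closure (region c₁ c₂), regionProj c₁ c₂ z ∈ Z → ∃ K, IsGoodNhd c₁ c₂ z K) :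
    IsOneDimCW (ReebSpace (hypersurfaceProj m c₁ c₂)) :=
  isOneDimCW_reebSpace_hypersurface hm (h₁.1.of_le (by exact_mod_cast le_top))
    (h₂.1.of_le (by exact_mod_cast le_top)) hlt hm2
    (critIsolated_of_goodNhds hZclosed hVclosed hVdiscrete hK)
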